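/- **Setting.** $n$ agents solve $\min_{x\in\mathbb R^d}\Phi(x)$, $\Phi=\frac1n\sum_{i=1}^n\Phi_i$, $\Phi_i(x)=\max_{y\in\mathcal Y_i}f_i(x,y)$, with $f_i:\mathbb R^d\times\mathcal Y_i\to\mathbb R$ and $\mathcal Y_i\subset\mathbb R^{p_i}$ convex and compact, of positive diameter at most $D$. Each $f_i$ has a gradient $\nabla f_i=(\nabla_xf_i,\nabla_yf_i)$ on $\mathbb R^d\times\mathcal Y_i$ with $\|\nabla f_i(x,y)-\nabla f_i(x',y')\|\le L(\|x-x'\|+\|y-y'\|)$ and is $\mu$-strongly concave in $y$, $\mu>0$: $f_i(x,y)\le f_i(x,y')+\langle\nabla_yf_i(x,y'),y-y'\rangle-\frac\mu2\|y-y'\|^2$. Put $\kappa=L/\mu$, and let $\Phi\ge\Phi^*$. The agents form a connected undirected graph; the mixing matrix $W=(w_{ij})\in\mathbb R^{n\times n}$ is nonnegative and symmetric with row sums $1$, for $i\ne j$ its entry $w_{ij}$ is positive on edges and zero otherwise, and the spectral norm $\lambda$ of $W-\frac1n\mathbf 1\mathbf 1^{\mathrm T}$ satisfies $\lambda<1$.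 Agent $i$ has a stochastic oracle $h_i=(h_{x,i},h_{y,i})$ (jointly measurable) with $\mathbb E[h_i(x,y,\xi_i)]=\nabla f_i(x,y)$ and $\mathbb E\|h_i(x,y,\xi_i)-\nabla f_i(x,y)\|^2\le\sigma^2$ for all $x\in\mathbb R^d$, $y\in\mathcal Y_i$. **DSGTA** with batch size $b\ge1$: from deterministic $x_i^0\in\mathbb R^d$, $y_i^0\in\mathcal Y_i$, with all samples $\xi_{i,j}^t$ independent, $\underline h_i^t=\frac1b\sum_{j=1}^bh_i(x_i^t,y_i^t,\xi_{i,j}^t)$ and $g_i^0=\underline h_{x,i}^0$, $$x_i^{t+1}=\sum_jw_{ij}(x_j^t-\eta_xg_j^t),\quad y_i^{t+1}=\mathrm{Proj}_{\mathcal Y_i}(y_i^t+\eta_y\underline h_{y,i}^t),\quad g_i^{t+1}=\sum_jw_{ij}(g_j^t+\underline h_{x,j}^{t+1}-\underline h_{x,j}^t).$$ The stepsizes are $$\eta_y=\frac{\sqrt{1-\lambda^2}}{9(L+\mu)},\qquad \eta_x=\frac1\gamma,\qquad \gamma=\frac{120\sqrt3\,\kappa L}{(1-\lambda^2)^2}+\frac{72\sqrt6\,\kappa^2(L+\mu)}{\sqrt{1-\lambda^2}}+\frac{110\,\kappa^{5/4}L}{(1-\lambda^2)^{9/8}}.$$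 Write $\bar x^t=\frac1n\sum_ix_i^t$, $\Delta_\Phi=\Phi(\bar x^0)-\Phi^*$, $X_0=\sum_i\|x_i^0-\bar x^0\|^2$, $G_0=\sum_i\|\nabla_xf_i(x_i^0,y_i^0)\|^2$ and $$K=\frac{\Delta_\Phi\kappa L}{(1-\lambda)^2}+\frac{\Delta_\Phi\kappa^2L}{\sqrt{1-\lambda}}+\frac{\kappa^2L^2X_0}{n(1-\lambda)}+\frac{D^2\kappa L^2}{\sqrt{1-\lambda}}+\frac{G_0}{n},$$ $$M=\frac{\Delta_\Phi L}{(1-\lambda)^2}+\frac{\Delta_\Phi L}{\sqrt{1-\lambda}}+\frac{L^2X_0}{n(1-\lambda)}+\frac{D^2L^2}{\sqrt{1-\lambda}}+\frac{G_0}{n}.$$ **Claim.** There is a numerical constant $C>0$ such that in every such setting $\Phi$ is differentiable and the following hold. 1. For all $b\ge1$ and $T\ge1$, each $\|\nabla\Phi(\bar x^t)\|^2$ is integrable and $$\frac1T\sum_{t=0}^{T-1}\mathbb E\|\nabla\Phi(\bar x^t)\|^2\le C\Big(\frac KT+\frac{\kappa\sigma^2}b\Big).$$ 2. For every $\varepsilon>0$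 there are integers $b,T\ge1$ with $\frac{\kappa\sigma^2}{\varepsilon^2}\le b\le C\max\{1,\frac{\kappa\sigma^2}{\varepsilon^2}\}$, with $$T\le C\max\{1,K/\varepsilon^2\}\quad\text{and}\quad T\le C\max\{1,\kappa^2M/\varepsilon^2\},$$ such that $\frac1T\sum_{t=0}^{T-1}\mathbb E\|\nabla\Phi(\bar x^t)\|^2\le\varepsilon^2$; in particular $\mathbb E\|\nabla\Phi(\bar x^t)\|^2\le\varepsilon^2$ for some $t<T$. The number of oracle queries of each agent in the initialization and these $T$ iterations is at most $C\max\{1,\frac{K}{\varepsilon^2}\}\max\{1,\frac{\kappa\sigma^2}{\varepsilon^2}\}$ and at most $C\max\{1,\frac{\kappa^2M}{\varepsilon^2}\}\max\{1,\frac{\kappa\sigma^2}{\varepsilon^2}\}$. Thus for small $\varepsilon$ and $\sigma>0$ the iteration complexity is $O(K\varepsilon^{-2})=O(\kappa^2\varepsilon^{-2})$ and the sample complexity is $O(K\kappa\sigma^2\varepsilon^{-4})=O(\kappa^3\varepsilon^{-4})$. 3. If moreover $\lambda=0$ (complete graph) and all $x_i^0$ coincide, then for the same $b,T$ the number of queries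 of each agent is at most $$C\max\Big\{1,\frac{\Delta_\Phi\kappa^2L+D^2\kappa L^2+G_0/n}{\varepsilon^2}\Big\}\max\Big\{1,\frac{\kappa\sigma^2}{\varepsilon^2}\Big\},$$ which has the order of centralized SGDA. -/

import Mathlib

open MeasureTheory ProbabilityTheory
open scoped RealInnerProductSpace

universe u v

noncomputable section

namespace DSGTA

/-- The space `ℝᵏ` with the Euclidean norm. -/
abbrev Vec (k : ℕ) : Type := EuclideanSpace ℝ (Fin k)

/-- The space `ℝᵈ × ℝᵏ` with the Euclidean norm `‖(x, y)‖² = ‖x‖² + ‖y‖²`. Its two blocks are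
`z.fst` and `z.snd`. -/
abbrev Pair (d k : ℕ) : Type := WithLp 2 (Vec d × Vec k)

/-- Data of a distributed stochastic min-max problem over a network of `n` agents, with a common
variable `x ∈ ℝᵈ` and private variables `yᵢ ∈ 𝒴ᵢ ⊆ ℝ^{pᵢ}`. Only data are collected here; what is
assumed about them is stated in the predicates below. The functions `f i`, `grad i` and `oracle i`
are only ever relevant at points `(x, y)` with `y ∈ 𝒴ᵢ`. -/
structure Problem (n d : ℕ) (p : Fin n → ℕ) (Ξ : Fin n → Type u)
    [∀ i, MeasurableSpace (Ξ i)] where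
  /-- communication graph (every agent is moreover its own neighbor) -/
  graph : SimpleGraph (Fin n)
  /-- mixing matrix -/
  W : Matrix (Fin n) (Fin n) ℝ
  /-- constraint sets -/
  Y : (i : Fin n) → Set (Vec (p i))
  /-- local objectives -/
  f : (i : Fin n) → Vec d → Vec (p i) → ℝ
  /-- gradients `∇fᵢ = (∇ₓfᵢ, ∇ᵧfᵢ)` of the local objectives -/
  grad : (i : Fin n) → Vec d → Vec (p i) → Pair d (p i)
  /-- law of one sample of agent `i` -/
  law : (i : Fin n) → Measure (Ξ i)
  /-- stochastic first-order oracle `hᵢ(x, y, ξ) = (h_{x,i}, h_{y,i})(x, y, ξ)` -/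
  oracle : (i : Fin n) → Vec d → Vec (p i) → Ξ i → Pair d (p i)
  /-- smoothness constant -/
  L : ℝ
  /-- strong concavity constant -/
  mu : ℝ
  /-- diameter (bound) of the constraint sets -/
  D : ℝ
  /-- standard deviation (bound) of the oracle -/
  sigma : ℝ
  /-- lower bound of the primal function -/
  PhiStar : ℝ
  /-- initial points -/
  x0 : Fin n → Vec d
  /-- initial points -/
  y0 : (i : Fin n) → Vec (p i)

/-- Average over the agents. -/
def avg {n d : ℕ} (x : Fin n → Vec d) : Vec d := (n : ℝ)⁻¹ • ∑ i, x i

/-- Euclidean projection: the nearest point of `S` to `u` (if there is one, e.g. if `S` is nonempty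
and compact; it is then unique if `S` is convex). -/
def proj {k : ℕ} (S : Set (Vec k)) (u : Vec k) : Vec k :=
  open Classical in
  if h : ∃ z ∈ S, ∀ w ∈ S, dist u z ≤ dist u w then h.choose else u

theorem proj_spec {k : ℕ} {S : Set (Vec k)} (hS : IsCompact S) (hne : S.Nonempty) (u : Vec k) :
    proj S u ∈ S ∧ ∀ w ∈ S, dist u (proj S u) ≤ dist u w := by
  have h : ∃ z ∈ S, ∀ w ∈ S, dist u z ≤ dist u w := by
    obtain ⟨z, hz, hmin⟩ := hS.exists_isMinOn hne
      (f := fun w => dist u w) (by fun_prop)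
    exact ⟨z, hz, fun w hw => hmin hw⟩
  unfold proj
  rw [dif_pos h]
  exact h.choose_spec

/-- State of the algorithm after some iteration: local iterates `xᵢ`, `yᵢ`, current mini-batch
stochastic gradients `(h_{x,i}, h_{y,i})`, gradient trackers `gᵢ`, and the number of oracle
queries that each agent has made so far. -/
structure State (n d : ℕ) (p : Fin n → ℕ) where
  x : Fin n → Vec d
  y : (i : Fin n) → Vec (p i)
  h : (i : Fin n) → Pair d (p i)
  g : Fin n → Vec d
  calls : Fin n → ℕ

namespace Problem

variable {n d : ℕ} {p : Fin n → ℕ} {Ξ : Fin n → Type u} [∀ i, MeasurableSpace (Ξ i)]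

/-! ### Derived quantities -/

/-- Condition number `κ = L / μ`. -/
def kappa (P : Problem n d p Ξ) : ℝ := P.L / P.mu

/-- Spectral norm `λ` of `W - 𝟏𝟏ᵀ/n`. -/
def lam (P : Problem n d p Ξ) : ℝ :=
  ‖Matrix.toEuclideanCLM (n := Fin n) (𝕜 := ℝ) (P.W - Matrix.of fun _ _ => (n : ℝ)⁻¹)‖

/-- Local primal function `Φᵢ(x) = max_{y ∈ 𝒴ᵢ} fᵢ(x, y)`. -/
def PhiLoc (P : Problem n d p Ξ) (i : Fin n) (x : Vec d) : ℝ := sSup (P.f i x '' P.Y i)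

/-- Primal function `Φ = (1/n) ∑ᵢ Φᵢ`. -/
def Phi (P : Problem n d p Ξ) (x : Vec d) : ℝ := (n : ℝ)⁻¹ * ∑ i, P.PhiLoc i x

/-- Initial gap `Δ_Φ = Φ(x̄⁰) - Φ*`. -/
def gap (P : Problem n d p Ξ) : ℝ := P.Phi (avg P.x0) - P.PhiStar

/-- Initial consensus error `‖𝐱⁰ - 𝟏(x̄⁰)ᵀ‖²`. -/
def consErr (P : Problem n d p Ξ) : ℝ := ∑ i, ‖P.x0 i - avg P.x0‖ ^ 2

/-- `∑ᵢ ‖∇ₓfᵢ(xᵢ⁰, yᵢ⁰)‖²`. -/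
def gradSq (P : Problem n d p Ξ) : ℝ := ∑ i, ‖(P.grad i (P.x0 i) (P.y0 i)).fst‖ ^ 2

/-! ### Assumptions -/

/-- The graph is undirected and connected, `W` is supported on its edges (and on the diagonal), and
`W` is nonnegative, symmetric and stochastic; the mixing is contractive, `λ < 1`. -/
structure NetworkAssumption (P : Problem n d p Ξ) : Prop where
  connected : P.graph.Connected
  edge : ∀ i j, i ≠ j → (P.graph.Adj i j ↔ 0 < P.W i j ∧ 0 < P.W j i)
  nonedge : ∀ i j, i ≠ j → ¬ P.graph.Adj i j → P.W i j = 0 ∧ P.W j i = 0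
  nonneg : ∀ i j, 0 ≤ P.W i j
  symm : P.W.transpose = P.W
  stochastic : ∀ i, ∑ j, P.W i j = 1
  lam_lt_one : P.lam < 1

/-- `grad i` is the gradient of `fᵢ` on `ℝᵈ × 𝒴ᵢ`, `fᵢ` is `L`-smooth there, and it is
`μ`-strongly concave in `y`. -/
structure ObjectiveAssumption (P : Problem n d p Ξ) : Prop where
  hasGrad : ∀ i, ∀ x, ∀ y ∈ P.Y i,
    HasGradientWithinAt (fun z : Pair d (p i) => P.f i z.fst z.snd) (P.grad i x y)
      {z | z.snd ∈ P.Y i} (WithLp.toLp 2 (x, y))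
  smooth : ∀ i, ∀ x x', ∀ y ∈ P.Y i, ∀ y' ∈ P.Y i,
    ‖P.grad i x y - P.grad i x' y'‖ ≤ P.L * (‖x - x'‖ + ‖y - y'‖)
  mu_pos : 0 < P.mu
  strongConcave : ∀ i, ∀ x, ∀ y ∈ P.Y i, ∀ y' ∈ P.Y i,
    P.f i x y ≤ P.f i x y' + ⟪(P.grad i x y').snd, y - y'⟫ - P.mu / 2 * ‖y - y'‖ ^ 2

/-- Each `𝒴ᵢ` is convex and compact, with a positive diameter that is at most `D`; the initial
`yᵢ⁰` are feasible. -/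
structure ConstraintAssumption (P : Problem n d p Ξ) : Prop where
  convex : ∀ i, Convex ℝ (P.Y i)
  compact : ∀ i, IsCompact (P.Y i)
  diam_pos : ∀ i, 0 < Metric.diam (P.Y i)
  diam_le : ∀ i, Metric.diam (P.Y i) ≤ P.D
  y0_mem : ∀ i, P.y0 i ∈ P.Y i

/-- `Φ` is bounded below by `Φ*`. -/
def LowerBoundAssumption (P : Problem n d p Ξ) : Prop := ∀ x, P.PhiStar ≤ P.Phi x

/-- The oracle is unbiased with variance at most `σ²` at every feasible point. -/
structure OracleAssumption (P : Problem n d p Ξ) : Prop where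
  prob : ∀ i, IsProbabilityMeasure (P.law i)
  meas : ∀ i, Measurable fun q : Vec d × Vec (p i) × Ξ i => P.oracle i q.1 q.2.1 q.2.2
  unbiased : ∀ i, ∀ x, ∀ y ∈ P.Y i, ∫ s, P.oracle i x y s ∂(P.law i) = P.grad i x y
  integrable : ∀ i, ∀ x, ∀ y ∈ P.Y i,
    Integrable (fun s => ‖P.oracle i x y s - P.grad i x y‖ ^ 2) (P.law i)
  variance : ∀ i, ∀ x, ∀ y ∈ P.Y i,
    ∫ s, ‖P.oracle i x y s - P.grad i x y‖ ^ 2 ∂(P.law i) ≤ P.sigma ^ 2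

/-- All standing assumptions together. -/
structure Assumptions (P : Problem n d p Ξ) : Prop where
  network : P.NetworkAssumption
  objective : P.ObjectiveAssumption
  constraint : P.ConstraintAssumption
  lowerBound : P.LowerBoundAssumption
  oracle : P.OracleAssumption

/-! ### The algorithm -/

/-- Mini-batch stochastic gradients `(1/b) ∑ⱼ hᵢ(xᵢ, yᵢ, ξᵢⱼ)`, from `b` oracle queries. -/
def miniBatch (P : Problem n d p Ξ) {b : ℕ} (s : (i : Fin n) → Fin b → Ξ i)
    (x : Fin n → Vec d) (y : (i : Fin n) → Vec (p i)) (i : Fin n) : Pair d (p i) :=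
  (b : ℝ)⁻¹ • ∑ j, P.oracle i (x i) (y i) (s i j)

/-- Initialization with the batch `s` of samples. -/
def init (P : Problem n d p Ξ) {b : ℕ} (s : (i : Fin n) → Fin b → Ξ i) : State n d p where
  x := P.x0
  y := P.y0
  h := P.miniBatch s P.x0 P.y0
  g := fun i => (P.miniBatch s P.x0 P.y0 i).fst
  calls := fun _ => b

/-- One iteration with stepsizes `ηₓ`, `ηᵧ` and the fresh batch `s` of samples. The sums over all
agents are the sums over the neighbors, because `wᵢⱼ` vanishes for the other agents. -/
def step (P : Problem n d p Ξ) {b : ℕ} (etaX etaY : ℝ) (s : (i : Fin n) → Fin b → Ξ i)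
    (st : State n d p) : State n d p :=
  let x' : Fin n → Vec d := fun i => ∑ j, P.W i j • (st.x j - etaX • st.g j)
  let y' : (i : Fin n) → Vec (p i) := fun i => proj (P.Y i) (st.y i + etaY • (st.h i).snd)
  let h' : (i : Fin n) → Pair d (p i) := P.miniBatch s x' y'
  { x := x'
    y := y'
    h := h'
    g := fun i => ∑ j, P.W i j • (st.g j + (h' j).fst - (st.h j).fst)
    calls := fun i => st.calls i + b }

/-- The state of DSGTA after `t` iterations, when `s t i j` is the `j`-th sample that agent `i`
draws for iterate number `t`. -/
def run (P : Problem n d p Ξ) {b : ℕ} (etaX etaY : ℝ)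
    (s : ℕ → (i : Fin n) → Fin b → Ξ i) : ℕ → State n d p
  | 0 => P.init (s 0)
  | t + 1 => P.step etaX etaY (s (t + 1)) (P.run etaX etaY s t)

/-- The samples `ξᵢⱼᵗ` are independent (over iterations, agents and batch positions), those of
agent `i` having the law `law i`. -/
structure IsSampling (P : Problem n d p Ξ) {b : ℕ} {Ω : Type v} [MeasurableSpace Ω]
    (Pr : Measure Ω) (ξ : ℕ → (i : Fin n) → Fin b → Ω → Ξ i) : Prop where
  prob : IsProbabilityMeasure Pr
  meas : ∀ t i j, Measurable (ξ t i j)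
  hasLaw : ∀ t i j, Pr.map (ξ t i j) = P.law i
  indep : iIndepFun (β := fun q : ℕ × Fin n × Fin b => Ξ q.2.1)
    (fun q => ξ q.1 q.2.1 q.2.2) Pr

/-! ### Stepsizes -/

/-- `ηᵧ = √(1 - λ²) / (9 (L + μ))`. -/
def etaY (P : Problem n d p Ξ) : ℝ := √(1 - P.lam ^ 2) / (9 * (P.L + P.mu))

/-- `γ`. -/
def gam (P : Problem n d p Ξ) : ℝ :=
  120 * √3 * P.kappa * P.L / (1 - P.lam ^ 2) ^ 2
    + 72 * √6 * P.kappa ^ 2 * (P.L + P.mu) / √(1 - P.lam ^ 2)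
    + 110 * P.kappa ^ (5 / 4 : ℝ) * P.L / (1 - P.lam ^ 2) ^ (9 / 8 : ℝ)

/-- `ηₓ = 1 / γ`. -/
def etaX (P : Problem n d p Ξ) : ℝ := 1 / P.gam

/-- The state of DSGTA after `t` iterations with these stepsizes, on the random samples `ξ`, at the
outcome `ω`. -/
def iter (P : Problem n d p Ξ) {b : ℕ} {Ω : Type v}
    (ξ : ℕ → (i : Fin n) → Fin b → Ω → Ξ i) (t : ℕ) (ω : Ω) : State n d p :=
  P.run P.etaX P.etaY (fun t i j => ξ t i j ω) t

/-- `‖∇Φ(x̄ᵗ)‖²` as a random variable. -/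
def gradPhiSq (P : Problem n d p Ξ) {b : ℕ} {Ω : Type v}
    (ξ : ℕ → (i : Fin n) → Fin b → Ω → Ξ i) (t : ℕ) (ω : Ω) : ℝ :=
  ‖gradient P.Phi (avg (P.iter ξ t ω).x)‖ ^ 2

/-! ### Coefficients of the rates -/

/-- The coefficient of `1/T` (and of `1/ε²` in the iteration complexity). -/
def rate (P : Problem n d p Ξ) : ℝ :=
  P.gap * P.kappa * P.L / (1 - P.lam) ^ 2
    + P.gap * P.kappa ^ 2 * P.L / √(1 - P.lam)
    + P.kappa ^ 2 * P.L ^ 2 * P.consErr / (n * (1 - P.lam))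
    + P.D ^ 2 * P.kappa * P.L ^ 2 / √(1 - P.lam)
    + P.gradSq / n

/-- A factor that does not involve `κ` and is used to display the dependence on `κ`. -/
def netFactor (P : Problem n d p Ξ) : ℝ :=
  P.gap * P.L / (1 - P.lam) ^ 2
    + P.gap * P.L / √(1 - P.lam)
    + P.L ^ 2 * P.consErr / (n * (1 - P.lam))
    + P.D ^ 2 * P.L ^ 2 / √(1 - P.lam)
    + P.gradSq / n

/-- The coefficient for a common initial point and a complete graph; it is free of network
quantities. -/
def centralRate (P : Problem n d p Ξ) : ℝ :=
  P.gap * P.kappa ^ 2 * P.L + P.D ^ 2 * P.kappa * P.L ^ 2 + P.gradSq / n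

end Problem

end DSGTA

end

/-! The maximizer of `f i x` over `Y i` is `κ`-Lipschitz in `x`, so Danskin's argument makes `Φ`
differentiable, with a quadratic remainder of order `κL` (`abs_phi_sub_le`). Mixing preserves
averages, and the trackers average to the current mini-batch gradients. Hence `x̄ᵗ` follows an
inexact gradient descent on `Φ`, whose error is controlled by the disagreement of the `xᵢ`, by the
distance of the `yᵢ` from the maximizers, and by noise (`phi_step_le`).

Each of these errors contracts up to multiples of the others. The disagreements of iterates and
trackers contract by the mixing at rate `(1 - λ²)/2`; the distance to the maximizers contracts at
rate `ηᵧμ/2`, because a projected ascent step beats the drift of the maximizer caused by moving `x̄`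
(`ascent_step_le`, `trackErr_step_le`). Summed over time, the recursions become a finite cyclic
system of linear inequalities. A small `ηₓ` makes the gain around the cycle less than one, and the
squared mean gradient that is left over is absorbed by the same quantity in the descent inequality
(`sum_norm_sq_grad_le`).

All this is done for every single outcome, with the noise kept explicitly
(`sum_norm_sq_gradPhi_le`). It enters through its square and through two correlations with
quantities determined by earlier samples. Only afterwards are expectations taken: independence
annihilates the correlations, and averaging a batch bounds the squares by `σ²/b` per agent
(`average_gradPhiSq_le`). The complexity claims follow by choosing `b` and `T` as rounded multiples
of `κσ²/ε²` and `K/ε²`. -/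

noncomputable section

namespace DSGTA

/-! ### Averages, Young-type inequalities and contraction by mixing -/

theorem sum_sub_avg {n d : ℕ} (hn : n ≠ 0) (u : Fin n → Vec d) : ∑ i, (u i - avg u) = 0 := by
  have : (n : ℝ) ≠ 0 := by exact_mod_cast hn
  simp [avg, Finset.sum_sub_distrib, ← Nat.cast_smul_eq_nsmul ℝ, smul_smul, this]

theorem avg_add {n d : ℕ} (u v : Fin n → Vec d) : avg (fun i => u i + v i) = avg u + avg v := by
  simp [avg, Finset.sum_add_distrib]

theorem avg_sub {n d : ℕ} (u v : Fin n → Vec d) : avg (fun i => u i - v i) = avg u - avg v := by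
  simp [avg, Finset.sum_sub_distrib, smul_sub]

theorem avg_smul {n d : ℕ} (c : ℝ) (u : Fin n → Vec d) : avg (fun i => c • u i) = c • avg u := by
  simp only [avg, ← Finset.smul_sum]
  rw [smul_comm]

theorem sum_norm_sq_sub_avg_le {n d : ℕ} (hn : n ≠ 0) (u : Fin n → Vec d) :
    ∑ i, ‖u i - avg u‖ ^ 2 ≤ ∑ i, ‖u i‖ ^ 2 := by
  have h0 : ∑ i, ⟪u i - avg u, avg u⟫ = 0 := by
    rw [← sum_inner, sum_sub_avg hn, inner_zero_left]
  have h1 : ∀ i, ‖u i‖ ^ 2 = ‖u i - avg u‖ ^ 2 + 2 * ⟪u i - avg u, avg u⟫ + ‖avg u‖ ^ 2 := by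
    intro i
    rw [← norm_add_sq_real, sub_add_cancel]
  simp only [h1, Finset.sum_add_distrib, ← Finset.mul_sum, h0]
  have : 0 ≤ ∑ _i : Fin n, ‖avg u‖ ^ 2 := Finset.sum_nonneg fun _ _ => by positivity
  linarith

theorem card_mul_norm_sq_avg_le {n d : ℕ} (hn : n ≠ 0) (u : Fin n → Vec d) :
    n * ‖avg u‖ ^ 2 ≤ ∑ i, ‖u i‖ ^ 2 := by
  have h0 : ∑ i, ⟪u i - avg u, avg u⟫ = 0 := by
    rw [← sum_inner, sum_sub_avg hn, inner_zero_left]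
  have h1 : ∀ i, ‖u i‖ ^ 2 = ‖u i - avg u‖ ^ 2 + 2 * ⟪u i - avg u, avg u⟫ + ‖avg u‖ ^ 2 := by
    intro i
    rw [← norm_add_sq_real, sub_add_cancel]
  simp only [h1, Finset.sum_add_distrib, ← Finset.mul_sum, h0]
  have : 0 ≤ ∑ i, ‖u i - avg u‖ ^ 2 := Finset.sum_nonneg fun _ _ => by positivity
  simp
  linarith

/-- Young's inequality with parameter `(1 - r)/(2r)`, applied later with `r = λ²`. Multiplying by `1
- r` and completing a square avoids a division by `r`, so `λ = 0` is included. -/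
theorem norm_add_sq_le_weighted {E : Type*} [SeminormedAddCommGroup E] {r : ℝ} (h0 : 0 ≤ r)
    (h1 : r < 1) (u v : E) :
    r * ‖u + v‖ ^ 2 ≤ (1 - (1 - r) / 2) * ‖u‖ ^ 2 + 2 / (1 - r) * ‖v‖ ^ 2 := by
  have hs : 0 < 1 - r := by linarith
  have h2 : ‖u + v‖ ^ 2 ≤ (‖u‖ + ‖v‖) ^ 2 := by
    gcongr
    exact norm_add_le u v
  set a := ‖u‖
  set b := ‖v‖
  have h3 : r * ‖u + v‖ ^ 2 ≤ r * (a + b) ^ 2 := by gcongr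
  refine h3.trans ?_
  rw [← sub_nonneg]
  have : (1 - (1 - r) / 2) * a ^ 2 + 2 / (1 - r) * b ^ 2 - r * (a + b) ^ 2
      = (((1 - r) * a - 2 * r * b) ^ 2 / 2 + b ^ 2 * ((1 - r) * (2 + r))) / (1 - r) := by
    field_simp
    ring
  rw [this]
  positivity

theorem norm_add_sq_le_two {E : Type*} [SeminormedAddCommGroup E] (u v : E) :
    ‖u + v‖ ^ 2 ≤ 2 * ‖u‖ ^ 2 + 2 * ‖v‖ ^ 2 := by
  have h2 : ‖u + v‖ ^ 2 ≤ (‖u‖ + ‖v‖) ^ 2 := by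
    gcongr
    exact norm_add_le u v
  nlinarith [sq_nonneg (‖u‖ - ‖v‖)]

theorem norm_add_sq_le_three {E : Type*} [SeminormedAddCommGroup E] (u v w : E) :
    ‖u + v + w‖ ^ 2 ≤ 3 * ‖u‖ ^ 2 + 3 * ‖v‖ ^ 2 + 3 * ‖w‖ ^ 2 := by
  have h2 : ‖u + v + w‖ ^ 2 ≤ (‖u‖ + ‖v‖ + ‖w‖) ^ 2 := by
    gcongr
    exact norm_add₃_le
  nlinarith [sq_nonneg (‖u‖ - ‖v‖), sq_nonneg (‖u‖ - ‖w‖), sq_nonneg (‖v‖ - ‖w‖)]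

theorem norm_add_sq_le_scaled {E : Type*} [SeminormedAddCommGroup E] {a : ℝ} (ha : 0 < a)
    (u v : E) : ‖u + v‖ ^ 2 ≤ (1 + a / 2) * ‖u‖ ^ 2 + (1 + 2 / a) * ‖v‖ ^ 2 := by
  have h2 : ‖u + v‖ ^ 2 ≤ (‖u‖ + ‖v‖) ^ 2 := by
    gcongr
    exact norm_add_le u v
  refine h2.trans ?_
  rw [← sub_nonneg]
  have : (1 + a / 2) * ‖u‖ ^ 2 + (1 + 2 / a) * ‖v‖ ^ 2 - (‖u‖ + ‖v‖) ^ 2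
      = (a * ‖u‖ - 2 * ‖v‖) ^ 2 / (2 * a) := by
    field_simp
    ring
  rw [this]
  positivity

/-- The matrix acts on each of the `d` coordinates separately, so the operator norm bound on `ℝⁿ` is
applied coordinate by coordinate and summed. -/
theorem sum_norm_sq_matrix_le {n d : ℕ} (A : Matrix (Fin n) (Fin n) ℝ) (u : Fin n → Vec d) :
    ∑ i, ‖∑ j, A i j • u j‖ ^ 2
      ≤ ‖Matrix.toEuclideanCLM (n := Fin n) (𝕜 := ℝ) A‖ ^ 2 * ∑ i, ‖u i‖ ^ 2 := by
  simp only [EuclideanSpace.real_norm_sq_eq]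
  rw [Finset.sum_comm, Finset.sum_comm (f := fun i k => u i k ^ 2), Finset.mul_sum]
  refine Finset.sum_le_sum fun k _ => ?_
  have h := (Matrix.toEuclideanCLM (n := Fin n) (𝕜 := ℝ) A).le_opNorm
    (WithLp.toLp 2 fun j => u j k)
  have h2 := pow_le_pow_left₀ (norm_nonneg _) h 2
  rw [mul_pow, EuclideanSpace.real_norm_sq_eq, EuclideanSpace.real_norm_sq_eq] at h2
  simpa [Matrix.mulVec, dotProduct] using h2

namespace Problem

variable {n d : ℕ} {p : Fin n → ℕ} {Ξ : Fin n → Type u} [∀ i, MeasurableSpace (Ξ i)]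
  {P : Problem n d p Ξ}

theorem NetworkAssumption.card_ne_zero (h : P.NetworkAssumption) : n ≠ 0 := by
  rintro rfl
  obtain ⟨i⟩ := h.connected.nonempty
  exact i.elim0

theorem lam_nonneg (P : Problem n d p Ξ) : 0 ≤ P.lam := norm_nonneg _

/-- By symmetry the column sums of `W` are also `1`. -/
theorem NetworkAssumption.avg_mix (h : P.NetworkAssumption) (u : Fin n → Vec d) :
    avg (fun i => ∑ j, P.W i j • u j) = avg u := by
  unfold avg
  congr 1
  rw [Finset.sum_comm]
  refine Finset.sum_congr rfl fun j _ => ?_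
  rw [← Finset.sum_smul]
  have : ∑ i, P.W i j = 1 := by
    rw [← h.stochastic j]
    refine Finset.sum_congr rfl fun i _ => ?_
    conv_lhs => rw [← h.symm]
    rfl
  rw [this, one_smul]

/-- Both `W` and the averaging matrix fix constant families, so their difference can be applied to
the deviations from the mean; its norm is `λ`. -/
theorem NetworkAssumption.sum_norm_sq_mix_le (h : P.NetworkAssumption) (u : Fin n → Vec d) :
    ∑ i, ‖∑ j, P.W i j • u j - avg u‖ ^ 2 ≤ P.lam ^ 2 * ∑ i, ‖u i - avg u‖ ^ 2 := by
  have hn : (n : ℝ) ≠ 0 := by exact_mod_cast h.card_ne_zero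
  have key : ∀ i, ∑ j, P.W i j • u j - avg u
      = ∑ j, (P.W - Matrix.of fun _ _ => (n : ℝ)⁻¹ : Matrix (Fin n) (Fin n) ℝ) i j • (u j - avg u) := by
    intro i
    simp only [Matrix.sub_apply, Matrix.of_apply, smul_sub, sub_smul, Finset.sum_sub_distrib,
      ← Finset.sum_smul, ← Finset.smul_sum, h.stochastic i]
    simp [hn, avg]
  simp only [key]
  exact sum_norm_sq_matrix_le _ _

theorem NetworkAssumption.sum_norm_sq_mix_add_le (h : P.NetworkAssumption) (u v : Fin n → Vec d) :
    ∑ i, ‖∑ j, P.W i j • (u j + v j) - (avg u + avg v)‖ ^ 2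
      ≤ (1 - (1 - P.lam ^ 2) / 2) * ∑ i, ‖u i - avg u‖ ^ 2
        + 2 / (1 - P.lam ^ 2) * ∑ i, ‖v i - avg v‖ ^ 2 := by
  have h1 := h.sum_norm_sq_mix_le (fun i => u i + v i)
  rw [avg_add] at h1
  refine h1.trans ?_
  rw [Finset.mul_sum, Finset.mul_sum, Finset.mul_sum, ← Finset.sum_add_distrib]
  refine Finset.sum_le_sum fun i _ => ?_
  rw [add_sub_add_comm]
  exact norm_add_sq_le_weighted (sq_nonneg _)
    (by nlinarith [h.lam_lt_one, P.lam_nonneg]) _ _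

end Problem

/-! ### Euclidean projection onto a compact convex set -/

section Projection

variable {k : ℕ} {S : Set (Vec k)}

theorem inner_sub_proj_le (hc : Convex ℝ S) (hS : IsCompact S) (hne : S.Nonempty) (u : Vec k)
    {w : Vec k} (hw : w ∈ S) : ⟪u - proj S u, w - proj S u⟫ ≤ 0 := by
  obtain ⟨hm, hmin⟩ := proj_spec hS hne u
  refine (norm_eq_iInf_iff_real_inner_le_zero hc hm).1 ?_ w hw
  have : Nonempty S := hne.to_subtype
  refine le_antisymm (le_ciInf fun w => ?_) (ciInf_le ⟨0, ?_⟩ (⟨_, hm⟩ : S))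
  · simpa [dist_eq_norm] using hmin w w.2
  · rintro _ ⟨w, rfl⟩
    positivity

theorem proj_eq_self (hS : IsCompact S) {u : Vec k} (hu : u ∈ S) : proj S u = u := by
  have h := (proj_spec hS ⟨u, hu⟩ u).2 u hu
  rw [dist_self] at h
  exact (dist_le_zero.1 h).symm

/-- Adding the variational inequalities at the two projected points gives firm nonexpansiveness
(`h3`), hence the Lipschitz constant `1`. -/
theorem continuous_proj (hc : Convex ℝ S) (hS : IsCompact S) (hne : S.Nonempty) :
    Continuous (proj S) := by
  refine LipschitzWith.continuous (K := 1) (LipschitzWith.of_dist_le_mul fun u v => ?_)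
  have h1 := inner_sub_proj_le hc hS hne u (proj_spec hS hne v).1
  have h2 := inner_sub_proj_le hc hS hne v (proj_spec hS hne u).1
  rw [NNReal.coe_one, one_mul, dist_eq_norm, dist_eq_norm]
  set a := proj S u
  set b := proj S v
  have h3 : ‖a - b‖ ^ 2 ≤ ⟪u - v, a - b⟫ := by
    have e1 : ⟪u - a, b - a⟫ = - ⟪u - a, a - b⟫ := by rw [← inner_neg_right, neg_sub]
    have e2 : ⟪u - v, a - b⟫ = ⟪u - a, a - b⟫ - ⟪v - b, a - b⟫ + ⟪a - b, a - b⟫ := by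
      rw [← inner_sub_left, ← inner_add_left]
      congr 1
      abel
    rw [e2, real_inner_self_eq_norm_sq]
    linarith
  have h4 := h3.trans (real_inner_le_norm _ _)
  by_contra h
  push Not at h
  nlinarith [norm_nonneg (u - v)]

end Projection

/-! ### Consequences of smoothness and strong concavity -/

namespace Problem

variable {n d : ℕ} {p : Fin n → ℕ} {Ξ : Fin n → Type u} [∀ i, MeasurableSpace (Ξ i)]
  {P : Problem n d p Ξ}

theorem ConstraintAssumption.nonempty (h : P.ConstraintAssumption) (i : Fin n) : (P.Y i).Nonempty :=
  ⟨_, h.y0_mem i⟩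

theorem ConstraintAssumption.dist_le (h : P.ConstraintAssumption) {i : Fin n} {y y' : Vec (p i)}
    (hy : y ∈ P.Y i) (hy' : y' ∈ P.Y i) : ‖y - y'‖ ≤ P.D := by
  rw [← dist_eq_norm]
  exact (Metric.dist_le_diam_of_mem (h.compact i).isBounded hy hy').trans (h.diam_le i)

/-- Mean value inequality on the segment between the two points, which stays feasible by convexity.
The gradient deviation is bounded by its worst value on the segment, so the constant below is `L`
rather than `L/2`. -/
theorem Assumptions.abs_sub_linear_le (h : P.Assumptions) {i : Fin n} (x x' : Vec d)
    {y y' : Vec (p i)} (hy : y ∈ P.Y i) (hy' : y' ∈ P.Y i) (hL : 0 ≤ P.L) :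
    |P.f i x' y' - P.f i x y - (⟪(P.grad i x y).fst, x' - x⟫ + ⟪(P.grad i x y).snd, y' - y⟫)|
      ≤ P.L * (‖x' - x‖ + ‖y' - y‖) * ‖(WithLp.toLp 2 (x' - x, y' - y) : Pair d (p i))‖ := by
  set z : Pair d (p i) := WithLp.toLp 2 (x, y) with hz
  set z' : Pair d (p i) := WithLp.toLp 2 (x', y') with hz'
  have hseg : ∀ w ∈ segment ℝ z z', w.snd ∈ P.Y i ∧
      ‖w.fst - x‖ + ‖w.snd - y‖ ≤ ‖x' - x‖ + ‖y' - y‖ := by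
    intro w hw
    rw [segment_eq_image'] at hw
    obtain ⟨θ, ⟨h0, h1⟩, rfl⟩ := hw
    constructor
    · exact (h.constraint.convex i).add_smul_sub_mem hy hy' ⟨h0, h1⟩
    · have e1 : (z + θ • (z' - z)).fst - x = θ • (x' - x) := by simp [hz, hz']
      have e2 : (z + θ • (z' - z)).snd - y = θ • (y' - y) := by simp [hz, hz']
      rw [e1, e2, norm_smul, norm_smul, Real.norm_of_nonneg h0]
      nlinarith [norm_nonneg (x' - x), norm_nonneg (y' - y)]
  have key := Convex.norm_image_sub_le_of_norm_hasFDerivWithin_le' (𝕜 := ℝ)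
    (f := fun z : Pair d (p i) => P.f i z.fst z.snd) (s := segment ℝ z z')
    (f' := fun w => InnerProductSpace.toDual ℝ _ (P.grad i w.fst w.snd))
    (φ := InnerProductSpace.toDual ℝ _ (P.grad i x y)) (x := z) (y := z')
    (C := P.L * (‖x' - x‖ + ‖y' - y‖))
    (fun w hw => ((h.objective.hasGrad i w.fst w.snd (hseg w hw).1).hasFDerivWithinAt).mono
      fun w hw => (hseg w hw).1)
    (fun w hw => by
      rw [← map_sub, LinearIsometryEquiv.norm_map]
      exact (h.objective.smooth i _ _ _ (hseg w hw).1 _ hy).trans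
        (mul_le_mul_of_nonneg_left (hseg w hw).2 hL))
    (convex_segment _ _) (left_mem_segment ℝ _ _) (right_mem_segment ℝ _ _)
  rw [Real.norm_eq_abs, InnerProductSpace.toDual_apply_apply, WithLp.prod_inner_apply] at key
  exact key

/-- The positive diameter supplies two distinct points of some `Y i`. Strong concavity between them
in both directions bounds the variation of the gradient from below by `μ`, smoothness bounds it from
above by `L`. -/
theorem Assumptions.mu_le_L (h : P.Assumptions) : P.mu ≤ P.L := by
  have i : Fin n := ⟨0, Nat.pos_of_ne_zero h.network.card_ne_zero⟩
  have hd := h.constraint.diam_pos i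
  have : ¬ (P.Y i).Subsingleton := fun hs => by
    rw [Metric.diam_subsingleton hs] at hd
    exact lt_irrefl _ hd
  rw [Set.not_subsingleton_iff] at this
  obtain ⟨y, hy, y', hy', hne⟩ := this
  have h1 := h.objective.strongConcave i 0 y hy y' hy'
  have h2 := h.objective.strongConcave i 0 y' hy' y hy
  have h3 := h.objective.smooth i 0 0 y hy y' hy'
  have hpos : 0 < ‖y - y'‖ := norm_pos_iff.2 (sub_ne_zero.2 hne)
  have h4 : ⟪(P.grad i 0 y').snd, y - y'⟫ + ⟪(P.grad i 0 y).snd, y' - y⟫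
      = ⟪(P.grad i 0 y' - P.grad i 0 y).snd, y - y'⟫ := by
    rw [WithLp.sub_snd, inner_sub_left, ← neg_sub y y', inner_neg_right]
    ring
  have h5 : ⟪(P.grad i 0 y' - P.grad i 0 y).snd, y - y'⟫ ≤ P.L * ‖y - y'‖ * ‖y - y'‖ := by
    refine (real_inner_le_norm _ _).trans ?_
    gcongr
    refine (WithLp.norm_snd_le _ _).trans ?_
    rw [norm_sub_rev]
    simpa using h3
  rw [norm_sub_rev y' y] at h2
  have h6 : P.mu * ‖y - y'‖ ^ 2 ≤ P.L * ‖y - y'‖ ^ 2 := by nlinarith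
  exact le_of_mul_le_mul_right h6 (by positivity)

theorem Assumptions.mu_pos (h : P.Assumptions) : 0 < P.mu := h.objective.mu_pos

theorem Assumptions.L_pos (h : P.Assumptions) : 0 < P.L := h.mu_pos.trans_le h.mu_le_L

theorem Assumptions.one_le_kappa (h : P.Assumptions) : 1 ≤ P.kappa :=
  (one_le_div h.mu_pos).2 h.mu_le_L

theorem Assumptions.abs_sub_linear_fst_le (h : P.Assumptions) {i : Fin n} (x x' : Vec d)
    {y : Vec (p i)} (hy : y ∈ P.Y i) :
    |P.f i x' y - P.f i x y - ⟪(P.grad i x y).fst, x' - x⟫| ≤ P.L * ‖x' - x‖ ^ 2 := by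
  have := h.abs_sub_linear_le x x' hy hy h.L_pos.le
  simpa [WithLp.norm_toLp_fst, pow_two, mul_assoc] using this

theorem Assumptions.abs_sub_linear_snd_le (h : P.Assumptions) {i : Fin n} (x : Vec d)
    {y y' : Vec (p i)} (hy : y ∈ P.Y i) (hy' : y' ∈ P.Y i) :
    |P.f i x y' - P.f i x y - ⟪(P.grad i x y).snd, y' - y⟫| ≤ P.L * ‖y' - y‖ ^ 2 := by
  have := h.abs_sub_linear_le x x hy hy' h.L_pos.le
  simpa [WithLp.norm_toLp_snd, pow_two, mul_assoc] using this

/-! ### The maximizer and the primal function -/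

theorem Assumptions.continuousOn_f (h : P.Assumptions) (i : Fin n) (x : Vec d) :
    ContinuousOn (P.f i x) (P.Y i) := by
  intro y hy
  have h1 : Filter.Tendsto (fun y' => ‖(P.grad i x y).snd‖ * ‖y' - y‖ + P.L * ‖y' - y‖ ^ 2)
      (nhdsWithin y (P.Y i)) (nhds 0) := by
    have : Continuous fun y' => ‖(P.grad i x y).snd‖ * ‖y' - y‖ + P.L * ‖y' - y‖ ^ 2 := by
      fun_prop
    simpa using (this.tendsto y).mono_left nhdsWithin_le_nhds
  refine tendsto_iff_dist_tendsto_zero.2 (squeeze_zero' (.of_forall fun _ => dist_nonneg) ?_ h1)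
  filter_upwards [self_mem_nhdsWithin] with y' hy'
  have h2 := abs_le.1 (h.abs_sub_linear_snd_le x hy hy')
  have h3 := abs_le.1 (abs_real_inner_le_norm (P.grad i x y).snd (y' - y))
  rw [Real.dist_eq, abs_le]
  constructor <;> linarith

/-- The maximizer of `fᵢ(x, ·)` over `𝒴ᵢ`. -/
def argmax (P : Problem n d p Ξ) (i : Fin n) (x : Vec d) : Vec (p i) :=
  open Classical in
  if h : ∃ y ∈ P.Y i, ∀ y' ∈ P.Y i, P.f i x y' ≤ P.f i x y then h.choose else 0

theorem Assumptions.argmax_spec (h : P.Assumptions) (i : Fin n) (x : Vec d) :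
    P.argmax i x ∈ P.Y i ∧ ∀ y' ∈ P.Y i, P.f i x y' ≤ P.f i x (P.argmax i x) := by
  have h' : ∃ y ∈ P.Y i, ∀ y' ∈ P.Y i, P.f i x y' ≤ P.f i x y :=
    (h.constraint.compact i).exists_isMaxOn (h.constraint.nonempty i) (h.continuousOn_f i x)
  rw [argmax, dif_pos h']
  exact h'.choose_spec

theorem Assumptions.argmax_mem (h : P.Assumptions) (i : Fin n) (x : Vec d) :
    P.argmax i x ∈ P.Y i := (h.argmax_spec i x).1

theorem Assumptions.phiLoc_eq (h : P.Assumptions) (i : Fin n) (x : Vec d) :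
    P.PhiLoc i x = P.f i x (P.argmax i x) := by
  obtain ⟨h1, h2⟩ := h.argmax_spec i x
  refine IsGreatest.csSup_eq ⟨⟨_, h1, rfl⟩, ?_⟩
  rintro _ ⟨y, hy, rfl⟩
  exact h2 y hy

/-- First-order optimality. A positive slope `c` towards `y` would beat the quadratic remainder for
a short enough step along the segment, contradicting maximality. -/
theorem Assumptions.inner_argmax_le (h : P.Assumptions) (i : Fin n) (x : Vec d) {y : Vec (p i)}
    (hy : y ∈ P.Y i) : ⟪(P.grad i x (P.argmax i x)).snd, y - P.argmax i x⟫ ≤ 0 := by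
  obtain ⟨h1, h2⟩ := h.argmax_spec i x
  set y₀ := P.argmax i x
  set c := ⟪(P.grad i x y₀).snd, y - y₀⟫
  by_contra hc
  push Not at hc
  have hL := h.L_pos
  have key : ∀ θ : ℝ, 0 < θ → θ ≤ 1 → c ≤ P.L * θ * ‖y - y₀‖ ^ 2 := by
    intro θ h0 h1'
    have hm : y₀ + θ • (y - y₀) ∈ P.Y i :=
      (h.constraint.convex i).add_smul_sub_mem h1 hy ⟨h0.le, h1'⟩
    have h3 := (abs_le.1 (h.abs_sub_linear_snd_le x h1 hm)).1
    have h4 := h2 _ hm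
    rw [add_sub_cancel_left, inner_smul_right, norm_smul, Real.norm_of_nonneg h0.le] at h3
    have h5 : θ * c ≤ θ * (P.L * θ * ‖y - y₀‖ ^ 2) := by nlinarith
    exact le_of_mul_le_mul_left h5 h0
  have hB : 0 < P.L * ‖y - y₀‖ ^ 2 := by
    have := key 1 one_pos le_rfl
    linarith
  set B := P.L * ‖y - y₀‖ ^ 2
  -- With this step length the remainder is at most `c / 2`, which is less than `c`.
  have h6 := key (min 1 (c / (2 * B))) (by positivity) (min_le_left _ _)
  have h7 : P.L * min 1 (c / (2 * B)) * ‖y - y₀‖ ^ 2 ≤ c / (2 * B) * B := by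
    have : P.L * min 1 (c / (2 * B)) * ‖y - y₀‖ ^ 2 = min 1 (c / (2 * B)) * B := by
      simp only [B]; ring
    rw [this]
    gcongr
    exact min_le_right _ _
  have h8 : c / (2 * B) * B = c / 2 := by field_simp
  linarith

theorem Assumptions.f_le_argmax_sub (h : P.Assumptions) (i : Fin n) (x : Vec d) {y : Vec (p i)}
    (hy : y ∈ P.Y i) :
    P.f i x y ≤ P.f i x (P.argmax i x) - P.mu / 2 * ‖y - P.argmax i x‖ ^ 2 := by
  have h1 := h.objective.strongConcave i x y hy _ (h.argmax_mem i x)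
  have h2 := h.inner_argmax_le i x hy
  linarith

/-- Strong concavity at `x` in both directions and the optimality conditions at `x` and `x'` give
`μ‖y - y'‖² ≤ ⟪∇ᵧf(x, y') - ∇ᵧf(x', y'), y - y'⟫`; smoothness in `x` bounds the right side. -/
theorem Assumptions.norm_argmax_sub_le (h : P.Assumptions) (i : Fin n) (x x' : Vec d) :
    ‖P.argmax i x - P.argmax i x'‖ ≤ P.kappa * ‖x - x'‖ := by
  have hy := h.argmax_mem i x
  have hy' := h.argmax_mem i x'
  have h1 := h.inner_argmax_le i x hy'
  have h2 := h.inner_argmax_le i x' hy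
  set y := P.argmax i x
  set y' := P.argmax i x'
  have h3 := h.objective.strongConcave i x y hy y' hy'
  have h4 := h.objective.strongConcave i x y' hy' y hy
  have h5 := h.objective.smooth i x x' y' hy' y' hy'
  rw [sub_self, norm_zero, add_zero] at h5
  have h6 : ⟪(P.grad i x y' - P.grad i x' y').snd, y - y'⟫ ≤ P.L * ‖x - x'‖ * ‖y - y'‖ := by
    refine (real_inner_le_norm _ _).trans ?_
    gcongr
    exact (WithLp.norm_snd_le _ _).trans h5
  rw [WithLp.sub_snd, inner_sub_left] at h6
  rw [norm_sub_rev y' y] at h4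
  have h7 : P.mu * ‖y - y'‖ ^ 2 ≤ P.L * ‖x - x'‖ * ‖y - y'‖ := by nlinarith
  rw [kappa, div_mul_eq_mul_div, le_div_iff₀ h.mu_pos]
  rcases (norm_nonneg (y - y')).eq_or_lt with h0 | h0
  · rw [← h0, zero_mul]
    have := h.L_pos
    positivity
  · nlinarith

/-- The gradient of the primal function, `(1/n) ∑ᵢ ∇ₓfᵢ(x, yᵢ*(x))`. -/
def gradPhi (P : Problem n d p Ξ) (x : Vec d) : Vec d :=
  avg fun i => (P.grad i x (P.argmax i x)).fst

/-- Danskin's argument. Testing the maximum at `x'` with the maximizer at `x` gives the lower bound.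
Testing the maximum at `x` with the maximizer at `x'` gives the upper bound, after the gradient is
moved from one maximizer to the other at cost `κL‖x' - x‖²`; together with `L ≤ κL` this makes
`2κL`. -/
theorem Assumptions.abs_phiLoc_sub_le (h : P.Assumptions) (i : Fin n) (x x' : Vec d) :
    |P.PhiLoc i x' - P.PhiLoc i x - ⟪(P.grad i x (P.argmax i x)).fst, x' - x⟫|
      ≤ 2 * P.kappa * P.L * ‖x' - x‖ ^ 2 := by
  rw [h.phiLoc_eq, h.phiLoc_eq]
  have hy := h.argmax_mem i x
  have hy' := h.argmax_mem i x'
  have hL := h.L_pos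
  have hk := h.one_le_kappa
  have h1 := (abs_le.1 (h.abs_sub_linear_fst_le x x' hy)).1
  have h2 := (abs_le.1 (h.abs_sub_linear_fst_le x x' hy')).2
  have h3 := (h.argmax_spec i x').2 _ hy
  have h4 := (h.argmax_spec i x).2 _ hy'
  have h5 := h.objective.smooth i x x _ hy' _ hy
  have h6 := h.norm_argmax_sub_le i x' x
  set y := P.argmax i x
  set y' := P.argmax i x'
  rw [sub_self, norm_zero, zero_add] at h5
  have h7 : ⟪(P.grad i x y' - P.grad i x y).fst, x' - x⟫
      ≤ P.L * (P.kappa * ‖x' - x‖) * ‖x' - x‖ := by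
    refine (real_inner_le_norm _ _).trans ?_
    gcongr
    exact (WithLp.norm_fst_le _ _).trans (h5.trans (by gcongr))
  rw [WithLp.sub_fst, inner_sub_left] at h7
  have h8 : P.L * ‖x' - x‖ ^ 2 ≤ P.kappa * P.L * ‖x' - x‖ ^ 2 := by
    have : 0 ≤ P.L * ‖x' - x‖ ^ 2 := by positivity
    nlinarith
  have h9 : 0 ≤ P.L * ‖x' - x‖ ^ 2 := by positivity
  rw [abs_le]
  constructor <;> nlinarith

theorem Assumptions.abs_phi_sub_le (h : P.Assumptions) (x x' : Vec d) :
    |P.Phi x' - P.Phi x - ⟪P.gradPhi x, x' - x⟫| ≤ 2 * P.kappa * P.L * ‖x' - x‖ ^ 2 := by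
  have hn : (0 : ℝ) < n := by exact_mod_cast Nat.pos_of_ne_zero h.network.card_ne_zero
  have e : P.Phi x' - P.Phi x - ⟪P.gradPhi x, x' - x⟫ = (n : ℝ)⁻¹ *
      ∑ i, (P.PhiLoc i x' - P.PhiLoc i x - ⟪(P.grad i x (P.argmax i x)).fst, x' - x⟫) := by
    simp only [Phi, gradPhi, avg, Finset.sum_sub_distrib, real_inner_smul_left, sum_inner]
    ring
  rw [e, abs_mul, abs_of_pos (inv_pos.2 hn), inv_mul_le_iff₀ hn]
  refine (Finset.abs_sum_le_sum_abs _ _).trans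
    ((Finset.sum_le_sum fun i _ => h.abs_phiLoc_sub_le i x x').trans ?_)
  simp

theorem Assumptions.hasGradientAt_phi (h : P.Assumptions) (x : Vec d) :
    HasGradientAt P.Phi (P.gradPhi x) x := by
  rw [hasGradientAt_iff_isLittleO]
  have : (fun x' => P.Phi x' - P.Phi x - ⟪P.gradPhi x, x' - x⟫)
      =O[nhds x] fun x' => ‖x' - x‖ ^ 2 := by
    refine Asymptotics.IsBigO.of_bound (2 * P.kappa * P.L) (Filter.Eventually.of_forall fun x' => ?_)
    rw [Real.norm_eq_abs, Real.norm_of_nonneg (by positivity)]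
    exact h.abs_phi_sub_le x x'
  refine this.trans_isLittleO ?_
  have h2 := (Asymptotics.isLittleO_norm_pow_id (E' := Vec d) one_lt_two).comp_tendsto
    (k := fun x' => x' - x) (l' := nhds x) (by
      have : Filter.Tendsto (fun x' => x' - x) (nhds x) (nhds (x - x)) := by
        apply Continuous.tendsto
        fun_prop
      simpa using this)
  exact h2

theorem Assumptions.differentiable_phi (h : P.Assumptions) : Differentiable ℝ P.Phi :=
  fun x => (h.hasGradientAt_phi x).differentiableAt

theorem Assumptions.gradient_phi (h : P.Assumptions) (x : Vec d) :
    gradient P.Phi x = P.gradPhi x := (h.hasGradientAt_phi x).gradient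

theorem Assumptions.norm_gradPhi_sub_sq_le (h : P.Assumptions) (x : Vec d) (u : Fin n → Vec d)
    (y : (i : Fin n) → Vec (p i)) (hy : ∀ i, y i ∈ P.Y i) :
    ‖P.gradPhi x - avg fun i => (P.grad i (u i) (y i)).fst‖ ^ 2
      ≤ 2 * P.L ^ 2 / n * (∑ i, ‖u i - x‖ ^ 2 + ∑ i, ‖y i - P.argmax i x‖ ^ 2) := by
  have hn : (0 : ℝ) < n := by exact_mod_cast Nat.pos_of_ne_zero h.network.card_ne_zero
  rw [gradPhi, ← avg_sub, div_mul_eq_mul_div, le_div_iff₀ hn, mul_comm]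
  refine (card_mul_norm_sq_avg_le h.network.card_ne_zero _).trans ?_
  rw [← Finset.sum_add_distrib, Finset.mul_sum]
  refine Finset.sum_le_sum fun i _ => ?_
  have h1 := h.objective.smooth i x (u i) _ (h.argmax_mem i x) _ (hy i)
  have h2 := (WithLp.norm_fst_le _ (P.grad i x (P.argmax i x) - P.grad i (u i) (y i))).trans h1
  rw [WithLp.sub_fst] at h2
  have h3 := pow_le_pow_left₀ (norm_nonneg _) h2 2
  refine h3.trans ?_
  rw [norm_sub_rev x, norm_sub_rev (P.argmax i x), mul_pow, mul_comm 2, mul_assoc]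
  gcongr
  nlinarith [sq_nonneg (‖u i - x‖ - ‖y i - P.argmax i x‖)]

/-- One projected stochastic gradient ascent step for `fᵢ(x̄, ·)` with a gradient taken at `x`. -/
theorem Assumptions.ascent_step_le (h : P.Assumptions) {i : Fin n} (xb x : Vec d) {y : Vec (p i)}
    (hy : y ∈ P.Y i) (e : Vec (p i)) {η : ℝ} (hη : 0 < η) (hηL : η * P.L ≤ 1 / 9) :
    ‖proj (P.Y i) (y + η • ((P.grad i x y).snd + e)) - P.argmax i xb‖ ^ 2
        + 1 / 4 * ‖proj (P.Y i) (y + η • ((P.grad i x y).snd + e)) - y‖ ^ 2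
      ≤ (1 - η * P.mu) * ‖y - P.argmax i xb‖ ^ 2 + η * P.L ^ 2 / P.mu * ‖x - xb‖ ^ 2
        + 2 * η ^ 2 * ‖e‖ ^ 2 + 2 * η * ⟪e, y - P.argmax i xb⟫ := by
  have hmu := h.mu_pos
  have hL := h.L_pos
  have hz := h.argmax_mem i xb
  have hp := inner_sub_proj_le (h.constraint.convex i) (h.constraint.compact i)
    (h.constraint.nonempty i) (y + η • ((P.grad i x y).snd + e)) hz
  have hw := (proj_spec (h.constraint.compact i) (h.constraint.nonempty i)
    (y + η • ((P.grad i x y).snd + e))).1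
  set w := proj (P.Y i) (y + η • ((P.grad i x y).snd + e))
  have h1 := h.f_le_argmax_sub i xb hw
  have h2 := (abs_le.1 (h.abs_sub_linear_snd_le xb hy hw)).1
  have h3 := h.objective.strongConcave i xb _ hz y hy
  set z := P.argmax i xb
  set gb := (P.grad i xb y).snd
  have h4 : ⟪(P.grad i x y).snd - gb, w - z⟫ ≤ P.L * ‖x - xb‖ * ‖w - z‖ := by
    refine (real_inner_le_norm _ _).trans ?_
    gcongr
    rw [← WithLp.sub_snd]
    refine (WithLp.norm_snd_le _ _).trans ((h.objective.smooth i x xb y hy y hy).trans ?_)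
    simp
  set gx := (P.grad i x y).snd
  have e1 : ⟪y + η • (gx + e) - w, z - w⟫
      = ⟪y - w, z - w⟫ - η * (⟪gx - gb, w - z⟫ + (⟪gb, w - y⟫ - ⟪gb, z - y⟫)
        + ⟪e, w - y⟫ + ⟪e, y - z⟫) := by
    simp only [inner_sub_left, inner_sub_right, inner_add_left, real_inner_smul_left]
    ring
  -- Three-point identity: the projection inequality `hp` controls the inner product in it.
  have e2 : ‖y - z‖ ^ 2 = ‖w - y‖ ^ 2 + ‖w - z‖ ^ 2 - 2 * ⟪y - w, z - w⟫ := by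
    have := norm_sub_sq_real (y - w) (z - w)
    rw [sub_sub_sub_cancel_right, norm_sub_rev y w, norm_sub_rev z w] at this
    linarith
  rw [e1] at hp
  rw [norm_sub_rev z y] at h3
  -- The noise is split along `w - z = (w - y) + (y - z)`. The part against `w - y`, which depends
  -- on the same sample, is absorbed here; the part against `y - z` stays linear so that it can
  -- vanish in expectation.
  have h5 : 2 * η * ⟪e, w - y⟫ ≤ 1 / 2 * ‖w - y‖ ^ 2 + 2 * η ^ 2 * ‖e‖ ^ 2 := by
    have := real_inner_le_norm e (w - y)
    nlinarith [sq_nonneg (‖w - y‖ - 2 * η * ‖e‖)]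
  have h6 : 2 * η * (P.L * ‖x - xb‖ * ‖w - z‖)
      ≤ η * P.mu * ‖w - z‖ ^ 2 + η * P.L ^ 2 / P.mu * ‖x - xb‖ ^ 2 := by
    rw [← sub_nonneg]
    have : η * P.mu * ‖w - z‖ ^ 2 + η * P.L ^ 2 / P.mu * ‖x - xb‖ ^ 2
        - 2 * η * (P.L * ‖x - xb‖ * ‖w - z‖)
        = η * (P.mu * ‖w - z‖ - P.L * ‖x - xb‖) ^ 2 / P.mu := by
      field_simp
      ring
    rw [this]
    positivity
  have h7 : η * P.L * ‖w - y‖ ^ 2 ≤ 1 / 9 * ‖w - y‖ ^ 2 := by gcongr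
  have h8 : η * ⟪gx - gb, w - z⟫ ≤ η * (P.L * ‖x - xb‖ * ‖w - z‖) := by gcongr
  have h9 : η * (⟪gb, w - y⟫ - ⟪gb, z - y⟫) ≤ η * (P.L * ‖w - y‖ ^ 2
      - P.mu / 2 * ‖w - z‖ ^ 2 - P.mu / 2 * ‖y - z‖ ^ 2) :=
    mul_le_mul_of_nonneg_left (by linarith) hη.le
  -- The coefficient left for `‖w - y‖²` is `1 - 2/9 - 1/2 = 5/18`, which exceeds `1/4`.
  linarith [sq_nonneg ‖w - y‖]

/-! ### Error functionals of a state -/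

/-- Error of the mini-batch gradient of agent `i`. -/
def noise (P : Problem n d p Ξ) (st : State n d p) (i : Fin n) : Pair d (p i) :=
  st.h i - P.grad i (st.x i) (st.y i)

/-- Consensus error of a family of vectors. -/
def disagreement {n d : ℕ} (u : Fin n → Vec d) : ℝ := ∑ i, ‖u i - avg u‖ ^ 2

/-- Distance of the `yᵢ` to the maximizers at the average of the `xᵢ`. -/
def trackErr (P : Problem n d p Ξ) (st : State n d p) : ℝ :=
  ∑ i, ‖st.y i - P.argmax i (avg st.x)‖ ^ 2

/-- Squared norm of the average of the exact local gradients in `x`. -/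
def meanSq (P : Problem n d p Ξ) (st : State n d p) : ℝ :=
  ‖avg fun i => (P.grad i (st.x i) (st.y i)).fst‖ ^ 2

/-- Total squared error of the mini-batch gradients. -/
def noiseSq (P : Problem n d p Ξ) (st : State n d p) : ℝ := ∑ i, ‖P.noise st i‖ ^ 2

/-- Correlation of the gradient errors in `y` with the tracking errors. -/
def ascentCross (P : Problem n d p Ξ) (st : State n d p) : ℝ :=
  ∑ i, ⟪(P.noise st i).snd, st.y i - P.argmax i (avg st.x)⟫

/-- Correlation of the average gradient error in `x` with the gradient of `Φ`. -/
def descentCross (P : Problem n d p Ξ) (st : State n d p) : ℝ :=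
  ⟪P.gradPhi (avg st.x), avg fun i => (P.noise st i).fst⟫

/-- A state is consistent if the `yᵢ` are feasible and the trackers have the right average. -/
structure Consistent (P : Problem n d p Ξ) (st : State n d p) : Prop where
  y_mem : ∀ i, st.y i ∈ P.Y i
  avg_g : avg st.g = avg fun i => (st.h i).fst

theorem disagreement_nonneg {n d : ℕ} (u : Fin n → Vec d) : 0 ≤ disagreement u :=
  Finset.sum_nonneg fun _ _ => by positivity

theorem trackErr_nonneg (P : Problem n d p Ξ) (st : State n d p) : 0 ≤ P.trackErr st :=
  Finset.sum_nonneg fun _ _ => by positivity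

theorem noiseSq_nonneg (P : Problem n d p Ξ) (st : State n d p) : 0 ≤ P.noiseSq st :=
  Finset.sum_nonneg fun _ _ => by positivity

theorem Assumptions.card_pos (h : P.Assumptions) : (0 : ℝ) < n := by
  exact_mod_cast Nat.pos_of_ne_zero h.network.card_ne_zero

/-! ### One-step inequalities, valid for every outcome -/

section Step

variable {b : ℕ} {etaX etaY : ℝ} (s : (i : Fin n) → Fin b → Ξ i) {st : State n d p}

theorem Assumptions.avg_x_step (h : P.Assumptions) :
    avg (P.step etaX etaY s st).x = avg st.x - etaX • avg st.g := by
  change avg (fun i => ∑ j, P.W i j • (st.x j - etaX • st.g j)) = _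
  rw [h.network.avg_mix, avg_sub, avg_smul]

/-- The gradient increments telescope in the average of the trackers. -/
theorem Assumptions.consistent_step (h : P.Assumptions) (hc : P.Consistent st) :
    P.Consistent (P.step etaX etaY s st) := by
  refine ⟨fun i => (proj_spec (h.constraint.compact i) (h.constraint.nonempty i) _).1, ?_⟩
  change avg (fun i => ∑ j, P.W i j • (st.g j + ((P.step etaX etaY s st).h j).fst - (st.h j).fst))
    = _
  rw [h.network.avg_mix, avg_sub, avg_add, hc.avg_g]
  abel

theorem Assumptions.disagreement_x_step_le (h : P.Assumptions) :
    disagreement (P.step etaX etaY s st).x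
      ≤ (1 - (1 - P.lam ^ 2) / 2) * disagreement st.x
        + 2 / (1 - P.lam ^ 2) * (etaX ^ 2 * disagreement st.g) := by
  have h1 := h.network.sum_norm_sq_mix_add_le st.x (fun j => -etaX • st.g j)
  have e : (P.step etaX etaY s st).x = fun i => ∑ j, P.W i j • (st.x j + -etaX • st.g j) := by
    funext i
    simp [step, sub_eq_add_neg]
  unfold disagreement
  rw [h.avg_x_step, e]
  rw [avg_smul] at h1
  simp only [neg_smul, ← sub_eq_add_neg, neg_sub_neg] at h1 ⊢
  refine h1.trans_eq ?_
  congr 2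
  rw [Finset.mul_sum]
  refine Finset.sum_congr rfl fun i _ => ?_
  rw [← smul_sub, norm_smul, mul_pow, norm_sub_rev, Real.norm_eq_abs, sq_abs]

theorem Assumptions.disagreement_g_step_le (h : P.Assumptions) :
    disagreement (P.step etaX etaY s st).g
      ≤ (1 - (1 - P.lam ^ 2) / 2) * disagreement st.g + 2 / (1 - P.lam ^ 2) *
        ∑ i, ‖((P.step etaX etaY s st).h i).fst - (st.h i).fst‖ ^ 2 := by
  have h1 := h.network.sum_norm_sq_mix_add_le st.g
    (fun i => ((P.step etaX etaY s st).h i).fst - (st.h i).fst)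
  have e : (P.step etaX etaY s st).g = fun i => ∑ j, P.W i j •
      (st.g j + (((P.step etaX etaY s st).h j).fst - (st.h j).fst)) := by
    funext i
    simp [step, add_sub_assoc]
  have hs : 0 < 1 - P.lam ^ 2 := by nlinarith [h.network.lam_lt_one, P.lam_nonneg]
  have h2 : avg (P.step etaX etaY s st).g = avg st.g
      + avg fun i => ((P.step etaX etaY s st).h i).fst - (st.h i).fst := by
    rw [e, h.network.avg_mix, avg_add]
  unfold disagreement
  rw [h2]
  conv_lhs => rw [e]
  exact h1.trans (add_le_add le_rfl (mul_le_mul_of_nonneg_left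
    (sum_norm_sq_sub_avg_le h.network.card_ne_zero _) (by positivity)))

/-- The increment of mini-batch gradients consists of the change of the exact gradients and of two
noise terms. The change of `xᵢ` is measured through the two disagreements and the motion of the
average, which feeds the tracker error back into the other errors. -/
theorem Assumptions.sum_norm_sq_h_step_sub_le (h : P.Assumptions) (hc : P.Consistent st) :
    ∑ i, ‖((P.step etaX etaY s st).h i).fst - (st.h i).fst‖ ^ 2
      ≤ 6 * P.L ^ 2 * (3 * disagreement (P.step etaX etaY s st).x + 3 * disagreement st.x
          + 3 * n * (etaX ^ 2 * ‖avg st.g‖ ^ 2)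
          + ∑ i, ‖(P.step etaX etaY s st).y i - st.y i‖ ^ 2)
        + 3 * P.noiseSq (P.step etaX etaY s st) + 3 * P.noiseSq st := by
  have hc' := h.consistent_step (etaX := etaX) (etaY := etaY) s hc
  have havg := h.avg_x_step (etaX := etaX) (etaY := etaY) (st := st) s
  set st' := P.step etaX etaY s st
  have e : 6 * P.L ^ 2 * (3 * disagreement st'.x + 3 * disagreement st.x
          + 3 * n * (etaX ^ 2 * ‖avg st.g‖ ^ 2) + ∑ i, ‖st'.y i - st.y i‖ ^ 2)
        + 3 * P.noiseSq st' + 3 * P.noiseSq st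
      = ∑ i, (6 * P.L ^ 2 * (3 * ‖st'.x i - avg st'.x‖ ^ 2 + 3 * ‖st.x i - avg st.x‖ ^ 2
          + 3 * (etaX ^ 2 * ‖avg st.g‖ ^ 2) + ‖st'.y i - st.y i‖ ^ 2)
        + 3 * ‖P.noise st' i‖ ^ 2 + 3 * ‖P.noise st i‖ ^ 2) := by
    simp only [Finset.sum_add_distrib, ← Finset.mul_sum, disagreement, noiseSq,
      Finset.sum_const, Finset.card_univ, Fintype.card_fin, nsmul_eq_mul]
    ring
  rw [e]
  refine Finset.sum_le_sum fun i _ => ?_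
  have h1 : (st'.h i).fst - (st.h i).fst
      = (P.grad i (st'.x i) (st'.y i) - P.grad i (st.x i) (st.y i)).fst
        + (P.noise st' i).fst + (-(P.noise st i)).fst := by
    simp only [noise, WithLp.sub_fst, WithLp.neg_fst]
    abel
  rw [h1]
  refine (norm_add_sq_le_three _ _ _).trans ?_
  have h2 := pow_le_pow_left₀ (norm_nonneg _) (WithLp.norm_fst_le _ (P.noise st' i)) 2
  have h3 := pow_le_pow_left₀ (norm_nonneg _) (WithLp.norm_fst_le _ (-(P.noise st i))) 2
  rw [norm_neg] at h3
  have h4 := pow_le_pow_left₀ (norm_nonneg _) ((WithLp.norm_fst_le _ _).trans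
    (h.objective.smooth i (st'.x i) (st.x i) _ (hc'.y_mem i) _ (hc.y_mem i))) 2
  have h5 : ‖st'.x i - st.x i‖ ^ 2 ≤ 3 * ‖st'.x i - avg st'.x‖ ^ 2 + 3 * ‖st.x i - avg st.x‖ ^ 2
          + 3 * (etaX ^ 2 * ‖avg st.g‖ ^ 2) := by
    have e5 : st'.x i - st.x i
        = (st'.x i - avg st'.x) + -(st.x i - avg st.x) + -(etaX • avg st.g) := by
      rw [havg]
      abel
    rw [e5]
    refine (norm_add_sq_le_three _ _ _).trans_eq ?_
    rw [norm_neg, norm_neg, norm_smul, mul_pow, Real.norm_eq_abs, sq_abs]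
  have h6 : (P.L * (‖st'.x i - st.x i‖ + ‖st'.y i - st.y i‖)) ^ 2
      ≤ 2 * P.L ^ 2 * (‖st'.x i - st.x i‖ ^ 2 + ‖st'.y i - st.y i‖ ^ 2) := by
    nlinarith [mul_nonneg (sq_nonneg P.L) (sq_nonneg (‖st'.x i - st.x i‖ - ‖st'.y i - st.y i‖))]
  have h7 := mul_le_mul_of_nonneg_left h5 (by positivity : 0 ≤ 6 * P.L ^ 2)
  linarith

theorem Assumptions.ascent_sum_le (h : P.Assumptions) (hc : P.Consistent st) (hη : 0 < etaY)
    (hηL : etaY * P.L ≤ 1 / 9) :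
    ∑ i, ‖(P.step etaX etaY s st).y i - P.argmax i (avg st.x)‖ ^ 2
        + 1 / 4 * ∑ i, ‖(P.step etaX etaY s st).y i - st.y i‖ ^ 2
      ≤ (1 - etaY * P.mu) * P.trackErr st + etaY * P.L ^ 2 / P.mu * disagreement st.x
        + 2 * etaY ^ 2 * P.noiseSq st + 2 * etaY * P.ascentCross st := by
  simp only [trackErr, disagreement, noiseSq, ascentCross, Finset.mul_sum,
    ← Finset.sum_add_distrib]
  refine Finset.sum_le_sum fun i _ => ?_
  have h1 := h.ascent_step_le (avg st.x) (st.x i) (hc.y_mem i) (P.noise st i).snd hη hηL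
  have e : (P.grad i (st.x i) (st.y i)).snd + (P.noise st i).snd = (st.h i).snd := by
    rw [noise, WithLp.sub_snd]
    abel
  rw [e] at h1
  refine h1.trans ?_
  gcongr
  exact WithLp.norm_snd_le _ _

/-- The target moves with `x̄`, by at most `κ` times the step of the average. The parameter `τ` of
Young's inequality will be the ascent rate `ηᵧμ`, so that half of the contraction survives. -/
theorem Assumptions.trackErr_step_le (h : P.Assumptions) {τ : ℝ} (hτ : 0 < τ) :
    P.trackErr (P.step etaX etaY s st)
      ≤ (1 + τ / 2) * ∑ i, ‖(P.step etaX etaY s st).y i - P.argmax i (avg st.x)‖ ^ 2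
        + (1 + 2 / τ) * (P.kappa ^ 2 * (etaX ^ 2 * (n * ‖avg st.g‖ ^ 2))) := by
  have e : (1 + 2 / τ) * (P.kappa ^ 2 * (etaX ^ 2 * (n * ‖avg st.g‖ ^ 2)))
      = ∑ _i : Fin n, (1 + 2 / τ) * (P.kappa * (|etaX| * ‖avg st.g‖)) ^ 2 := by
    simp [mul_pow]
    ring
  rw [e, Finset.mul_sum, ← Finset.sum_add_distrib, trackErr]
  refine Finset.sum_le_sum fun i _ => ?_
  rw [← sub_add_sub_cancel _ (P.argmax i (avg st.x)) (P.argmax i _)]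
  refine (norm_add_sq_le_scaled hτ _ _).trans ?_
  gcongr
  refine (h.norm_argmax_sub_le i _ _).trans_eq ?_
  rw [h.avg_x_step, sub_sub_cancel, norm_smul, Real.norm_eq_abs]

theorem Assumptions.norm_sq_avg_g_le (h : P.Assumptions) (hc : P.Consistent st) :
    n * ‖avg st.g‖ ^ 2 ≤ 2 * (n * P.meanSq st) + 2 * P.noiseSq st := by
  have e : avg st.g = (avg fun i => (P.grad i (st.x i) (st.y i)).fst)
      + avg fun i => (P.noise st i).fst := by
    rw [hc.avg_g, ← avg_add]
    simp [noise]
  have h1 := norm_add_sq_le_two (avg fun i => (P.grad i (st.x i) (st.y i)).fst)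
    (avg fun i => (P.noise st i).fst)
  rw [← e] at h1
  have h2 := card_mul_norm_sq_avg_le h.network.card_ne_zero fun i => (P.noise st i).fst
  have h3 : ∑ i, ‖(P.noise st i).fst‖ ^ 2 ≤ P.noiseSq st := by
    refine Finset.sum_le_sum fun i _ => ?_
    gcongr
    exact WithLp.norm_fst_le _ _
  have h4 := mul_le_mul_of_nonneg_left h1 h.card_pos.le
  rw [meanSq]
  linarith

/-- Polarization turns `⟪∇Φ, v⟫`, with `v` the mean exact gradient, into `(‖∇Φ‖² + ‖v‖² - ‖∇Φ -
v‖²)/2`. The term `‖v‖²/2`, which is `meanSq / 2`, is retained because it later absorbs the squared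
search direction. -/
theorem Assumptions.phi_step_le (h : P.Assumptions) (hc : P.Consistent st) (hη : 0 < etaX) :
    P.Phi (avg (P.step etaX etaY s st).x) ≤ P.Phi (avg st.x)
      - etaX * (‖P.gradPhi (avg st.x)‖ ^ 2 / 2 + P.meanSq st / 2
        - P.L ^ 2 / n * (disagreement st.x + P.trackErr st) + P.descentCross st)
      + 2 * P.kappa * P.L * (etaX ^ 2 * ‖avg st.g‖ ^ 2) := by
  have h1 := (abs_le.1 (h.abs_phi_sub_le (avg st.x) (avg (P.step etaX etaY s st).x))).2
  have h2 := h.norm_gradPhi_sub_sq_le (avg st.x) st.x st.y hc.y_mem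
  have e : avg st.g = (avg fun i => (P.grad i (st.x i) (st.y i)).fst)
      + avg fun i => (P.noise st i).fst := by
    rw [hc.avg_g, ← avg_add]
    simp [noise]
  have e1 : avg (P.step etaX etaY s st).x - avg st.x = -(etaX • avg st.g) := by
    rw [h.avg_x_step]
    abel
  rw [e1, inner_neg_right, inner_smul_right, norm_neg, norm_smul, mul_pow, Real.norm_eq_abs,
    sq_abs] at h1
  have e2 : ⟪P.gradPhi (avg st.x), avg st.g⟫
      = ⟪P.gradPhi (avg st.x), avg fun i => (P.grad i (st.x i) (st.y i)).fst⟫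
        + P.descentCross st := by
    rw [descentCross, ← inner_add_right, ← e]
  rw [norm_sub_sq_real] at h2
  rw [e2] at h1
  have h3 : etaX * (‖P.gradPhi (avg st.x)‖ ^ 2 / 2 + P.meanSq st / 2
        - P.L ^ 2 / n * (disagreement st.x + P.trackErr st) + P.descentCross st)
      ≤ etaX * (⟪P.gradPhi (avg st.x), avg fun i => (P.grad i (st.x i) (st.y i)).fst⟫
        + P.descentCross st) := by
    refine mul_le_mul_of_nonneg_left ?_ hη.le
    have : 2 * P.L ^ 2 / n * (∑ i, ‖st.x i - avg st.x‖ ^ 2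
        + ∑ i, ‖st.y i - P.argmax i (avg st.x)‖ ^ 2)
        = 2 * (P.L ^ 2 / n * (disagreement st.x + P.trackErr st)) := by
      rw [disagreement, trackErr]
      ring
    rw [this] at h2
    unfold meanSq
    linarith
  linarith

theorem Assumptions.consistent_init (h : P.Assumptions) : P.Consistent (P.init s) :=
  ⟨h.constraint.y0_mem, rfl⟩

theorem Assumptions.consistent_run (h : P.Assumptions) (s : ℕ → (i : Fin n) → Fin b → Ξ i) (t : ℕ) :
    P.Consistent (P.run etaX etaY s t) := by
  induction t with
  | zero => exact h.consistent_init _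
  | succ t ih => exact h.consistent_step _ ih

end Step

end Problem

/-! ### Summation of the recursions -/

/-- Here the sum of `v` stops one term before that of `u`. This suits the trackers, whose
perturbation at time `t` involves quantities at time `t + 1`. -/
theorem sum_range_succ_le_of_contraction {a : ℝ} (ha1 : a ≤ 1) {u v : ℕ → ℝ}
    (hu : ∀ t, 0 ≤ u t) (h : ∀ t, u (t + 1) ≤ (1 - a) * u t + v t) (k : ℕ) :
    a * ∑ t ∈ Finset.range (k + 1), u t ≤ u 0 + ∑ t ∈ Finset.range k, v t := by
  have h1 : ∑ t ∈ Finset.range k, u (t + 1)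
      ≤ (1 - a) * ∑ t ∈ Finset.range k, u t + ∑ t ∈ Finset.range k, v t := by
    rw [Finset.mul_sum, ← Finset.sum_add_distrib]
    exact Finset.sum_le_sum fun t _ => h t
  have h2 : (1 - a) * ∑ t ∈ Finset.range k, u t
      ≤ (1 - a) * ∑ t ∈ Finset.range (k + 1), u t := by
    refine mul_le_mul_of_nonneg_left ?_ (by linarith)
    rw [Finset.sum_range_succ]
    linarith [hu k]
  have h3 := Finset.sum_range_succ' u k
  linarith

theorem sum_range_le_of_contraction {a : ℝ} {u v : ℕ → ℝ} (hu : ∀ t, 0 ≤ u t)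
    (h : ∀ t, u (t + 1) ≤ (1 - a) * u t + v t) (k : ℕ) :
    a * ∑ t ∈ Finset.range k, u t ≤ u 0 + ∑ t ∈ Finset.range k, v t := by
  have h1 : ∑ t ∈ Finset.range k, u (t + 1)
      ≤ (1 - a) * ∑ t ∈ Finset.range k, u t + ∑ t ∈ Finset.range k, v t := by
    rw [Finset.mul_sum, ← Finset.sum_add_distrib]
    exact Finset.sum_le_sum fun t _ => h t
  have h2 := Finset.sum_range_succ' u k
  rw [Finset.sum_range_succ] at h2
  linarith [hu k]

set_option maxHeartbeats 2000000 in
/-- Elimination of the auxiliary sums: `A`, `B` are the summed consensus errors of iterates and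
trackers, `Δ` the summed tracking error, `H` and `S` the summed squared increments of gradients and
of the `yᵢ`, `Q`, `M`, `F` the summed squared norms of search directions, mean gradients and
gradients of `Φ`, `E` the summed noise, `c` and `q` the summed noise correlations. -/
theorem sum_norm_sq_grad_le {L μ s ηx ηy γ n X0 G0 D0 gap A B Δ H S Q M E F c q : ℝ}
    (hμ : 0 < μ) (hμL : μ ≤ L) (hs0 : 0 < s) (hs1 : s ≤ 1) (hn : 0 < n)
    (hηx : 0 < ηx) (hηy : ηy = √s / (9 * (L + μ))) (hγ : ηx * γ = 1)
    (hx1 : ηx * (120 * √3 * (L / μ) * L) ≤ s ^ 2)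
    (hx2 : ηx * (72 * √6 * (L / μ) ^ 2 * (L + μ)) ≤ √s)
    (hX0 : 0 ≤ X0) (hA : 0 ≤ A) (hB : 0 ≤ B) (hΔ : 0 ≤ Δ) (hQ : 0 ≤ Q) (hM : 0 ≤ M) (hE : 0 ≤ E)
    (hG0 : 0 ≤ G0) (hD0 : 0 ≤ D0)
    (i1 : s / 2 * A ≤ X0 + 2 / s * (ηx ^ 2 * B))
    (i2 : s / 2 * B ≤ G0 + 2 / s * H)
    (i3 : H ≤ 6 * L ^ 2 * (6 * A + 3 * (ηx ^ 2 * (n * Q)) + S) + 6 * E)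
    (i4 : S ≤ 4 * Δ + 4 * (ηy * L ^ 2 / μ * A) + 8 * ηy ^ 2 * E + 8 * ηy * c)
    (i5 : ηy * μ / 2 * Δ ≤ D0 + (1 + ηy * μ / 2) * (ηy * L ^ 2 / μ * A + 2 * ηy ^ 2 * E
      + 2 * ηy * c) + (1 + 2 / (ηy * μ)) * ((L / μ) ^ 2 * (ηx ^ 2 * (n * Q))))
    (i6 : n * Q ≤ 2 * (n * M) + 2 * E)
    (i7 : ηx * (F / 2 + M / 2 - L ^ 2 / n * (A + Δ) + q) ≤ gap + 2 * (L / μ) * L * (ηx ^ 2 * Q)) :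
    F ≤ 2 * (gap * γ) + 30 * ((L / μ) ^ 2 * L ^ 2 * X0 / (n * s)) + G0 / n
      + 200 * (D0 * (L / μ) * L ^ 2 / (n * √s)) + 10 * ((L / μ) * E / n)
      + (16 + (8 + 56 / 225) * (ηy * μ)) * (L ^ 2 / (μ * n)) * c - 2 * q := by
  have hL : 0 < L := hμ.trans_le hμL
  have hr0 : 0 < √s := Real.sqrt_pos.2 hs0
  have hr1 : √s ≤ 1 := Real.sqrt_le_one.2 hs1
  have hrs : √s ^ 2 = s := Real.sq_sqrt hs0.le
  have hηy0 : 0 < ηy := by rw [hηy]; positivity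
  have hηyL : ηy * L ≤ 1 / 9 := by
    rw [hηy, div_mul_eq_mul_div, div_le_iff₀ (by positivity)]
    have : √s * L ≤ 1 * L := by gcongr
    linarith
  have hτ0 : 0 < ηy * μ := by positivity
  have hτ1 : ηy * μ ≤ 1 / 18 := by
    rw [hηy, div_mul_eq_mul_div, div_le_iff₀ (by positivity)]
    have : √s * μ ≤ 1 * μ := by gcongr
    linarith
  obtain ⟨τ, hτ⟩ : ∃ τ, τ = ηy * μ := ⟨_, rfl⟩
  obtain ⟨κ, hκ⟩ : ∃ κ, κ = L / μ := ⟨_, rfl⟩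
  have hκ1 : 1 ≤ κ := by rw [hκ]; exact (one_le_div hμ).2 hμL
  have hκL : L = κ * μ := by rw [hκ]; field_simp
  rw [← hκ] at hx1 hx2 i5 i7 ⊢
  rw [← hτ] at i5 hτ0 hτ1 ⊢
  -- consequences of the choice of the stepsizes
  have hs4 : ηx ^ 2 * κ ^ 2 * L ^ 2 ≤ s ^ 4 / 43200 := by
    have h1 := pow_le_pow_left₀ (by positivity) hx1 2
    have h2 : (ηx * (120 * √3 * κ * L)) ^ 2 = 14400 * √3 ^ 2 * (ηx ^ 2 * κ ^ 2 * L ^ 2) := by ring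
    rw [h2, Real.sq_sqrt (by norm_num)] at h1
    linarith
  have hs2 : ηx ^ 2 * κ ^ 4 * (L + μ) ^ 2 ≤ s / 31104 := by
    have h1 := pow_le_pow_left₀ (by positivity) hx2 2
    have h2 : (ηx * (72 * √6 * κ ^ 2 * (L + μ))) ^ 2
        = 5184 * √6 ^ 2 * (ηx ^ 2 * κ ^ 4 * (L + μ) ^ 2) := by ring
    rw [h2, Real.sq_sqrt (by norm_num), hrs] at h1
    linarith
  have hx3 : ηx * (κ * L) ≤ 1 / 120 := by
    have h1 : (1 : ℝ) ≤ √3 := Real.one_le_sqrt.2 (by norm_num)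
    have h3 : s ^ 2 ≤ 1 := pow_le_one₀ hs0.le hs1
    have h2 : ηx * (120 * 1 * κ * L) ≤ ηx * (120 * √3 * κ * L) := by gcongr
    linarith
  have hxL : ηx ^ 2 * L ^ 2 ≤ 1 / 43200 := by
    have h3 : s ^ 4 ≤ 1 := pow_le_one₀ hs0.le hs1
    have h4 : ηx ^ 2 * L ^ 2 ≤ ηx ^ 2 * κ ^ 2 * L ^ 2 := by
      rw [mul_right_comm]
      exact le_mul_of_one_le_right (by positivity) (one_le_pow₀ hκ1)
    linarith
  have hτs : τ ^ 2 * (81 * (L + μ) ^ 2) = s * μ ^ 2 := by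
    rw [hτ, hηy]
    field_simp
    rw [hrs]
    ring
  -- normalized sums
  obtain ⟨a, ha⟩ : ∃ a, a = κ ^ 2 * L ^ 2 * A / n := ⟨_, rfl⟩
  obtain ⟨a1, ha1⟩ : ∃ a1, a1 = L ^ 2 * A / n := ⟨_, rfl⟩
  obtain ⟨β, hβ⟩ : ∃ β, β = s ^ 2 * B / n := ⟨_, rfl⟩
  obtain ⟨δ, hδ⟩ : ∃ δ, δ = L ^ 2 * Δ / n := ⟨_, rfl⟩
  obtain ⟨ς, hς⟩ : ∃ ς, ς = L ^ 2 * S / n := ⟨_, rfl⟩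
  obtain ⟨e, he⟩ : ∃ e, e = E / n := ⟨_, rfl⟩
  obtain ⟨x0, hx0⟩ : ∃ x0, x0 = κ ^ 2 * L ^ 2 * X0 / (n * s) := ⟨_, rfl⟩
  obtain ⟨g0, hg0⟩ : ∃ g0, g0 = G0 / n := ⟨_, rfl⟩
  obtain ⟨c1, hc1⟩ : ∃ c1, c1 = L ^ 2 / (μ * n) * c := ⟨_, rfl⟩
  have ha10 : 0 ≤ a1 := by rw [ha1]; positivity
  have he0 : 0 ≤ e := by rw [he]; positivity
  have hδ0 : 0 ≤ δ := by rw [hδ]; positivity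
  have hg00 : 0 ≤ g0 := by rw [hg0]; positivity
  have haa : a = κ ^ 2 * a1 := by rw [ha, ha1]; ring
  have hκa : κ * a1 ≤ a := by
    have := mul_nonneg (mul_nonneg (zero_le_one.trans hκ1) (sub_nonneg.2 hκ1)) ha10
    rw [haa]
    linarith
  have ha1a : a1 ≤ a := (le_mul_of_one_le_left ha10 hκ1).trans hκa
  have hκe : e ≤ κ * e := le_mul_of_one_le_left he0 hκ1
  -- The weight `κ²` in `a` is the one with which the consensus error reaches the tracking error in
  -- `j5`. The first summand of `γ` gives `4 / 43200 = 1 / 10800`, where `43200 = 120² · 3`.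
  have j1 : a ≤ 2 * x0 + β / 10800 := by
    have h1 : a ≤ κ ^ 2 * L ^ 2 * (2 / s * (X0 + 2 / s * (ηx ^ 2 * B))) / n := by
      rw [ha]
      gcongr
      rw [div_mul_eq_mul_div, le_div_iff₀ hs0]
      linarith
    have h2 : κ ^ 2 * L ^ 2 * (2 / s * (X0 + 2 / s * (ηx ^ 2 * B))) / n
        = 2 * x0 + 4 * (ηx ^ 2 * κ ^ 2 * L ^ 2) * (B / (s ^ 2 * n)) := by
      rw [hx0]
      field_simp
      ring
    have h3 : 4 * (ηx ^ 2 * κ ^ 2 * L ^ 2) * (B / (s ^ 2 * n))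
        ≤ 4 * (s ^ 4 / 43200) * (B / (s ^ 2 * n)) := by gcongr
    have h4 : 4 * (s ^ 4 / 43200) * (B / (s ^ 2 * n)) = β / 10800 := by
      rw [hβ]
      field_simp
      ring
    linarith
  have j2 : β ≤ 2 * g0 + 4 * (H / n) := by
    have h1 : β ≤ s ^ 2 * (2 / s * (G0 + 2 / s * H)) / n := by
      rw [hβ]
      gcongr
      rw [div_mul_eq_mul_div, le_div_iff₀ hs0]
      linarith
    have h2 : s ^ 2 * (2 / s * (G0 + 2 / s * H)) / n = 2 * (s * g0) + 4 * (H / n) := by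
      rw [hg0]
      field_simp
      ring
    have h3 : s * g0 ≤ 1 * g0 := by gcongr
    linarith
  have j3 : H / n ≤ 36 * a1 + Q / 2400 + 6 * ς + 6 * e := by
    have h1 : H / n ≤ (6 * L ^ 2 * (6 * A + 3 * (ηx ^ 2 * (n * Q)) + S) + 6 * E) / n := by gcongr
    have h2 : (6 * L ^ 2 * (6 * A + 3 * (ηx ^ 2 * (n * Q)) + S) + 6 * E) / n
        = 36 * a1 + 18 * (ηx ^ 2 * L ^ 2 * Q) + 6 * ς + 6 * e := by
      rw [ha1, hς, he]
      field_simp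
      ring
    have h3 : ηx ^ 2 * L ^ 2 * Q ≤ 1 / 43200 * Q := by gcongr
    linarith
  have hηκ : ηy * L ^ 2 / μ ≤ κ / 9 := by
    have : ηy * L ^ 2 / μ = (ηy * L) * κ := by rw [hκ]; ring
    rw [this]
    have h1 : ηy * L * κ ≤ 1 / 9 * κ := by gcongr
    linarith
  have j4 : ς ≤ 4 * δ + 4 / 9 * a + 8 / 81 * e + 8 * (τ * c1) := by
    have h1 : ς ≤ L ^ 2 * (4 * Δ + 4 * (ηy * L ^ 2 / μ * A) + 8 * ηy ^ 2 * E + 8 * ηy * c) / n := by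
      rw [hς]
      gcongr
    have h2 : L ^ 2 * (4 * Δ + 4 * (ηy * L ^ 2 / μ * A) + 8 * ηy ^ 2 * E + 8 * ηy * c) / n
        = 4 * δ + 4 * (ηy * L ^ 2 / μ * a1) + 8 * ((ηy * L) ^ 2 * e) + 8 * (τ * c1) := by
      rw [hδ, ha1, he, hc1, hτ]
      field_simp
    have h3 : ηy * L ^ 2 / μ * a1 ≤ κ / 9 * a1 := by gcongr
    have h4 : (ηy * L) ^ 2 * e ≤ (1 / 9) ^ 2 * e := by gcongr
    linarith
  -- Dividing by the rate `τ / 2` turns `ηᵧL²/μ · A` into a multiple of `κ²A` and the drift of the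
  -- maximizers into `Q` with coefficient `(4 + 2τ)(κLηₓ/τ)²`.
  have j5 : δ ≤ 18 * 2 * (D0 * κ * L ^ 2 / (n * √s)) + 37 / 18 * a + 37 / 81 * (κ * e)
      + (4 + 2 * τ) * c1 + 5 / 384 * Q := by
    have h1 : δ ≤ L ^ 2 * (2 / τ * (D0 + (1 + τ / 2) * (ηy * L ^ 2 / μ * A + 2 * ηy ^ 2 * E
        + 2 * ηy * c) + (1 + 2 / τ) * (κ ^ 2 * (ηx ^ 2 * (n * Q))))) / n := by
      rw [hδ]
      gcongr
      rw [div_mul_eq_mul_div, le_div_iff₀ hτ0]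
      linarith
    have hηy' : ηy = τ / μ := by rw [hτ]; field_simp
    have h2 : L ^ 2 * (2 / τ * (D0 + (1 + τ / 2) * (ηy * L ^ 2 / μ * A + 2 * ηy ^ 2 * E
        + 2 * ηy * c) + (1 + 2 / τ) * (κ ^ 2 * (ηx ^ 2 * (n * Q))))) / n
        = 2 * (D0 * L ^ 2 / (n * τ)) + (1 + τ / 2) * (2 * a) + (1 + τ / 2) * (4 * (ηy * L) * (κ * e))
          + (4 + 2 * τ) * c1 + (2 * τ + 4) * (κ ^ 2 * L ^ 2 * ηx ^ 2 / τ ^ 2) * Q := by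
      rw [ha, he, hc1, hηy', hκ]
      field_simp
      ring
    have h3 : D0 * L ^ 2 / (n * τ) ≤ 18 * (D0 * κ * L ^ 2 / (n * √s)) := by
      have e1 : D0 * L ^ 2 / (n * τ) = (D0 * L ^ 2 / n) * (1 / τ) := by field_simp
      have e2 : 18 * (D0 * κ * L ^ 2 / (n * √s)) = (D0 * L ^ 2 / n) * (18 * κ / √s) := by
        field_simp
      rw [e1, e2]
      refine mul_le_mul_of_nonneg_left ?_ (by positivity)
      rw [div_le_div_iff₀ hτ0 hr0, hτ, hηy, hκ]
      have e3 : 18 * (L / μ) * (√s / (9 * (L + μ)) * μ) = 2 * L / (L + μ) * √s := by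
        field_simp
        norm_num
      rw [e3]
      gcongr
      rw [le_div_iff₀ (by positivity)]
      linarith
    have h4 : (1 + τ / 2) * (2 * a) ≤ 37 / 36 * (2 * a) := by
      have : 0 ≤ a := ha10.trans ha1a
      gcongr
      linarith
    have h5 : (1 + τ / 2) * (4 * (ηy * L) * (κ * e)) ≤ 37 / 36 * (4 * (1 / 9) * (κ * e)) := by
      gcongr
      linarith
    -- The second summand of `γ` matches the ascent rate: `81 / 31104 = 1 / 384`, where `31104 = 72²
    -- · 6`.
    have h6 : κ ^ 2 * L ^ 2 * ηx ^ 2 / τ ^ 2 ≤ 1 / 384 := by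
      have e1 : κ ^ 2 * L ^ 2 * ηx ^ 2 / τ ^ 2 = 81 / s * (ηx ^ 2 * κ ^ 4 * (L + μ) ^ 2) := by
        rw [div_eq_iff (by positivity), hκL]
        have := congrArg (fun z => z / s * (ηx ^ 2 * κ ^ 4)) hτs
        rw [hκL] at this
        have e4 : s * μ ^ 2 / s * (ηx ^ 2 * κ ^ 4) = κ ^ 2 * (κ * μ) ^ 2 * ηx ^ 2 := by
          field_simp
        rw [← e4]
        rw [← this]
        ring
      rw [e1]
      have : 81 / s * (ηx ^ 2 * κ ^ 4 * (L + μ) ^ 2) ≤ 81 / s * (s / 31104) := by gcongr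
      refine this.trans_eq ?_
      field_simp
      norm_num
    have h7 : (2 * τ + 4) * (κ ^ 2 * L ^ 2 * ηx ^ 2 / τ ^ 2) * Q ≤ 5 * (1 / 384) * Q := by
      gcongr
      linarith
    linarith
  have j6 : Q ≤ 2 * M + 2 * e := by
    have h1 : n * Q ≤ n * (2 * M + 2 * e) := by
      refine i6.trans_eq ?_
      rw [he]
      field_simp
    exact le_of_mul_le_mul_left h1 hn
  have j7 : F / 2 + M / 2 - (a1 + δ) + q ≤ gap * γ + 1 / 60 * Q := by
    have hγ0 : 0 < γ := pos_of_mul_pos_right (hγ ▸ one_pos) hηx.le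
    have h1 := mul_le_mul_of_nonneg_left i7 hγ0.le
    have e1 : γ * (ηx * (F / 2 + M / 2 - L ^ 2 / n * (A + Δ) + q))
        = (ηx * γ) * (F / 2 + M / 2 - (a1 + δ) + q) := by
      rw [ha1, hδ]
      ring
    have e2 : γ * (gap + 2 * κ * L * (ηx ^ 2 * Q))
        = gap * γ + (ηx * γ) * (2 * (ηx * (κ * L)) * Q) := by ring
    rw [e1, e2, hγ, one_mul, one_mul] at h1
    have h2 : 2 * (ηx * (κ * L)) * Q ≤ 2 * (1 / 120) * Q := by gcongr
    linarith
  have e1 : κ * E / n = κ * e := by rw [he]; ring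
  have e2 : (16 + (8 + 56 / 225) * τ) * (L ^ 2 / (μ * n)) * c
      = 16 * c1 + (8 + 56 / 225) * (τ * c1) := by rw [hc1]; ring
  rw [e1, e2, ← hx0, ← hg0]
  have hD1 : 0 ≤ D0 * κ * L ^ 2 / (n * √s) := by positivity
  have hx00 : 0 ≤ 2 * x0 + β / 10800 := (ha10.trans ha1a).trans j1
  -- The correlations have no sign, so they cannot be estimated and must keep exact coefficients.
  -- Treating `c1` and `τ * c1` as separate unknowns makes the remaining system linear.
  obtain ⟨c2, hc2⟩ : ∃ c2, c2 = τ * c1 := ⟨_, rfl⟩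
  have e3 : (4 + 2 * τ) * c1 = 4 * c1 + 2 * c2 := by rw [hc2]; ring
  rw [e3] at j5
  rw [← hc2] at j4 ⊢
  generalize D0 * κ * L ^ 2 / (n * √s) = D1 at *
  generalize κ * e = e' at *
  generalize H / n = H' at *
  generalize gap * γ = gg at *
  have hk : F / 2 + M / 2 + q ≤ gg + Q / 60 + a + δ := by linarith
  -- The cycle is closed: `a` is bounded by itself with a small factor. The final combination takes
  -- `hk` twice, `j5` four times and `m` fourteen times. This yields the coefficients `16 = 4 · 4`
  -- of `c1` and `8 + 56/225 = 4 · 2 + 14 · (192/10800)` of `c2`; with `j6`, the remaining multiple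
  -- of `M` is below the one available in `hk`.
  have m : a ≤ 2 * x0 + (2 * g0 + 4 * (36 * a + Q / 2400
    + 6 * (4 * δ + 4 / 9 * a + 8 / 81 * e + 8 * c2) + 6 * e)) / 10800 := by linarith
  have hx0' : 0 ≤ x0 := by rw [hx0]; positivity
  have ha0 : 0 ≤ a := ha10.trans ha1a
  clear j1 j2 j3 j4 j7 e1 e2 e3 hx0 hg0 ha ha1 hβ hδ hς he hc1 hc2 haa i1 i2 i3 i4 i5 i6 i7 hs4 hs2
    hxL hτs hx1 hx2 hx3
  linarith

/-- The third summand of `γ` is dominated by the other two, so it does not appear in the final rate.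
With `q = k^(1/4)` and `r = s^(1/8)` all exponents become integers, and the size of `q r⁷` decides
which of the two summands suffices. -/
theorem rpow_div_rpow_le {k s : ℝ} (hk : 1 ≤ k) (hs0 : 0 < s) (hs1 : s ≤ 1) :
    k ^ (5 / 4 : ℝ) / s ^ (9 / 8 : ℝ) ≤ k / s ^ 2 + k ^ 2 / √s := by
  have hk0 : 0 < k := by linarith
  obtain ⟨q, hq⟩ : ∃ q, q = k ^ (1 / 4 : ℝ) := ⟨_, rfl⟩
  obtain ⟨r, hr⟩ : ∃ r, r = s ^ (1 / 8 : ℝ) := ⟨_, rfl⟩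
  have hq0 : 0 < q := by rw [hq]; positivity
  have hr0 : 0 < r := by rw [hr]; positivity
  have hr1 : r ≤ 1 := by rw [hr]; exact Real.rpow_le_one hs0.le hs1 (by norm_num)
  have hq1 : k ^ (5 / 4 : ℝ) = q ^ 5 := by
    rw [hq, ← Real.rpow_mul_natCast hk0.le]; norm_num
  have hq2 : k = q ^ 4 := by
    rw [hq, ← Real.rpow_mul_natCast hk0.le]; norm_num
  have hr2 : s ^ (9 / 8 : ℝ) = r ^ 9 := by
    rw [hr, ← Real.rpow_mul_natCast hs0.le]; norm_num
  have hr3 : s = r ^ 8 := by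
    rw [hr, ← Real.rpow_mul_natCast hs0.le]; norm_num
  have hr4 : √s = r ^ 4 := by
    rw [hr3, show r ^ 8 = (r ^ 4) ^ 2 by ring, Real.sqrt_sq (by positivity)]
  rw [hq1, hr2, hr4, hr3, hq2]
  rcases le_total (q * r ^ 7) 1 with h | h
  · have h1 : q ^ 5 / r ^ 9 ≤ q ^ 4 / (r ^ 8) ^ 2 := by
      rw [div_le_div_iff₀ (by positivity) (by positivity)]
      calc q ^ 5 * (r ^ 8) ^ 2 = q ^ 4 * r ^ 9 * (q * r ^ 7) := by ring
        _ ≤ q ^ 4 * r ^ 9 * 1 := by gcongr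
        _ = q ^ 4 * r ^ 9 := mul_one _
    have h2 : 0 ≤ (q ^ 4) ^ 2 / r ^ 4 := by positivity
    linarith
  · have h1 : q ^ 5 / r ^ 9 ≤ (q ^ 4) ^ 2 / r ^ 4 := by
      rw [div_le_div_iff₀ (by positivity) (by positivity)]
      have h3 : 1 ≤ q ^ 3 * r ^ 5 := by
        calc 1 ≤ (q * r ^ 7) ^ 3 := one_le_pow₀ h
          _ = q ^ 3 * r ^ 5 * r ^ 16 := by ring
          _ ≤ q ^ 3 * r ^ 5 * 1 := by gcongr; exact pow_le_one₀ hr0.le hr1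
          _ = _ := mul_one _
      calc q ^ 5 * r ^ 4 = q ^ 5 * r ^ 4 * 1 := by ring
        _ ≤ q ^ 5 * r ^ 4 * (q ^ 3 * r ^ 5) := by gcongr
        _ = (q ^ 4) ^ 2 * r ^ 9 := by ring
    have h2 : 0 ≤ q ^ 4 / (r ^ 8) ^ 2 := by positivity
    linarith

/-- Summation of the recursions satisfied by the error quantities of the algorithm. -/
theorem sum_norm_sq_grad_le_of_recursions {L μ s ηx ηy γ n Φs : ℝ}
    {X G Y D S H Q M E F c q Φ : ℕ → ℝ} (hμ : 0 < μ) (hμL : μ ≤ L) (hs0 : 0 < s) (hs1 : s ≤ 1)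
    (hn : 0 < n) (hηx : 0 < ηx) (hηy : ηy = √s / (9 * (L + μ))) (hγ : ηx * γ = 1)
    (hx1 : ηx * (120 * √3 * (L / μ) * L) ≤ s ^ 2)
    (hx2 : ηx * (72 * √6 * (L / μ) ^ 2 * (L + μ)) ≤ √s)
    (hX : ∀ t, 0 ≤ X t) (hG : ∀ t, 0 ≤ G t) (hY : ∀ t, 0 ≤ Y t) (hD : ∀ t, 0 ≤ D t)
    (hS : ∀ t, 0 ≤ S t) (hQ : ∀ t, 0 ≤ Q t) (hM : ∀ t, 0 ≤ M t) (hE : ∀ t, 0 ≤ E t)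
    (hΦ : ∀ t, Φs ≤ Φ t)
    (r1 : ∀ t, X (t + 1) ≤ (1 - s / 2) * X t + 2 / s * (ηx ^ 2 * G t))
    (r2 : ∀ t, G (t + 1) ≤ (1 - s / 2) * G t + 2 / s * H t)
    (r3 : ∀ t, H t ≤ 6 * L ^ 2 * (3 * X (t + 1) + 3 * X t + 3 * n * (ηx ^ 2 * Q t) + S t)
      + 3 * E (t + 1) + 3 * E t)
    (r4 : ∀ t, D t + 1 / 4 * S t ≤ (1 - ηy * μ) * Y t + ηy * L ^ 2 / μ * X t
      + 2 * ηy ^ 2 * E t + 2 * ηy * c t)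
    (r5 : ∀ t, Y (t + 1) ≤ (1 + ηy * μ / 2) * D t
      + (1 + 2 / (ηy * μ)) * ((L / μ) ^ 2 * (ηx ^ 2 * (n * Q t))))
    (r6 : ∀ t, n * Q t ≤ 2 * (n * M t) + 2 * E t)
    (r7 : ∀ t, Φ (t + 1) ≤ Φ t
      - ηx * (F t / 2 + M t / 2 - L ^ 2 / n * (X t + Y t) + q t)
      + 2 * (L / μ) * L * (ηx ^ 2 * Q t)) (k : ℕ) :
    ∑ t ∈ Finset.range (k + 1), F t ≤ 2 * ((Φ 0 - Φs) * γ)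
      + 30 * ((L / μ) ^ 2 * L ^ 2 * X 0 / (n * s)) + G 0 / n
      + 200 * (Y 0 * (L / μ) * L ^ 2 / (n * √s))
      + 10 * ((L / μ) * (∑ t ∈ Finset.range (k + 1), E t) / n)
      + (16 + (8 + 56 / 225) * (ηy * μ)) * (L ^ 2 / (μ * n)) * (∑ t ∈ Finset.range (k + 1), c t)
      - 2 * ∑ t ∈ Finset.range (k + 1), q t := by
  have hL : 0 < L := hμ.trans_le hμL
  have hηy0 : 0 < ηy := by rw [hηy]; have := Real.sqrt_pos.2 hs0; positivity
  have hτ : 0 < ηy * μ := by positivity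
  have r4' : ∀ t, S t ≤ 4 * Y t + 4 * (ηy * L ^ 2 / μ * X t) + 8 * ηy ^ 2 * E t
      + 8 * ηy * c t := fun t => by
    have h2 := mul_nonneg hτ.le (hY t)
    linarith [r4 t, hD t]
  -- `(1 + τ/2)(1 - τ) ≤ 1 - τ/2` for `τ = ηᵧμ`.
  have r5' : ∀ t, Y (t + 1) ≤ (1 - ηy * μ / 2) * Y t
      + ((1 + ηy * μ / 2) * (ηy * L ^ 2 / μ * X t + 2 * ηy ^ 2 * E t + 2 * ηy * c t)
      + (1 + 2 / (ηy * μ)) * ((L / μ) ^ 2 * (ηx ^ 2 * (n * Q t)))) := fun t => by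
    have h2 := mul_le_mul_of_nonneg_left ((le_add_of_nonneg_right
      (mul_nonneg (by norm_num) (hS t))).trans (r4 t)) (by positivity : 0 ≤ 1 + ηy * μ / 2)
    have h3 := mul_nonneg (sq_nonneg (ηy * μ)) (hY t)
    linarith [r5 t]
  have r7' : ∀ t, ηx * (F t / 2 + M t / 2 - L ^ 2 / n * (X t + Y t) + q t)
      ≤ Φ t - Φ (t + 1) + 2 * (L / μ) * L * (ηx ^ 2 * Q t) := fun t => by linarith [r7 t]
  have hshift : ∀ {u : ℕ → ℝ}, (∀ t, 0 ≤ u t) →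
      ∑ t ∈ Finset.range k, u (t + 1) ≤ ∑ t ∈ Finset.range (k + 1), u t ∧
      ∑ t ∈ Finset.range k, u t ≤ ∑ t ∈ Finset.range (k + 1), u t := by
    intro u hu
    constructor
    · rw [Finset.sum_range_succ']
      linarith [hu 0]
    · rw [Finset.sum_range_succ]
      linarith [hu k]
  have nn : ∀ {u : ℕ → ℝ}, (∀ t, 0 ≤ u t) → 0 ≤ ∑ t ∈ Finset.range (k + 1), u t :=
    fun hu => Finset.sum_nonneg fun t _ => hu t
  have i1 := sum_range_le_of_contraction hX r1 (k + 1)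
  -- Summing `H` over `range k` only keeps the shifted terms `X (t + 1)` and `E (t + 1)` inside
  -- `range (k + 1)`.
  have i2 := sum_range_succ_le_of_contraction (by linarith) hG r2 k
  have i3 := Finset.sum_le_sum fun t (_ : t ∈ Finset.range k) => r3 t
  have i4 := Finset.sum_le_sum fun t (_ : t ∈ Finset.range (k + 1)) => r4' t
  have i5 := sum_range_le_of_contraction hY r5' (k + 1)
  have i6 := Finset.sum_le_sum fun t (_ : t ∈ Finset.range (k + 1)) => r6 t
  have i7 := Finset.sum_le_sum fun t (_ : t ∈ Finset.range (k + 1)) => r7' t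
  have htel := Finset.sum_range_sub' Φ (k + 1)
  simp only [Finset.sum_add_distrib, ← Finset.mul_sum, Finset.sum_sub_distrib,
    ← Finset.sum_div] at i1 i2 i3 i4 i5 i6 i7 htel
  refine sum_norm_sq_grad_le hμ hμL hs0 hs1 hn hηx hηy hγ hx1 hx2 (hX 0) (nn hX) (nn hG) (nn hY)
    (nn hQ) (nn hM) (nn hE) (hG 0) (hY 0) i1 i2 (S := ∑ t ∈ Finset.range (k + 1), S t) ?_ i4
    (by linarith) i6 ?_
  · refine i3.trans ?_
    have h1 : 3 * ∑ t ∈ Finset.range k, X (t + 1) + 3 * ∑ t ∈ Finset.range k, X t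
        + 3 * n * (ηx ^ 2 * ∑ t ∈ Finset.range k, Q t) + ∑ t ∈ Finset.range k, S t
        ≤ 6 * ∑ t ∈ Finset.range (k + 1), X t
        + 3 * (ηx ^ 2 * (n * ∑ t ∈ Finset.range (k + 1), Q t))
        + ∑ t ∈ Finset.range (k + 1), S t := by
      have h2 := mul_le_mul_of_nonneg_left (hshift hQ).2 (by positivity : 0 ≤ 3 * n * ηx ^ 2)
      linarith [(hshift hX).1, (hshift hX).2, (hshift hS).2]
    have h2 := mul_le_mul_of_nonneg_left h1 (by positivity : 0 ≤ 6 * L ^ 2)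
    linarith [(hshift hE).1, (hshift hE).2]
  · linarith [hΦ (k + 1)]

/-! ### Consequences of the stepsizes and the bound for a single outcome -/

namespace Problem

variable {n d : ℕ} {p : Fin n → ℕ} {Ξ : Fin n → Type u} [∀ i, MeasurableSpace (Ξ i)]
  {P : Problem n d p Ξ}

theorem Assumptions.gapSq_pos (h : P.Assumptions) : 0 < 1 - P.lam ^ 2 := by
  nlinarith [h.network.lam_lt_one, P.lam_nonneg]

theorem Assumptions.one_sub_lam_le (h : P.Assumptions) : 1 - P.lam ≤ 1 - P.lam ^ 2 := by
  nlinarith [h.network.lam_lt_one, P.lam_nonneg]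

theorem Assumptions.one_sub_lam_pos (h : P.Assumptions) : 0 < 1 - P.lam := by
  linarith [h.network.lam_lt_one]

theorem Assumptions.kappa_pos (h : P.Assumptions) : 0 < P.kappa := one_pos.trans_le h.one_le_kappa

theorem Assumptions.gap_nonneg (h : P.Assumptions) : 0 ≤ P.gap := sub_nonneg.2 (h.lowerBound _)

theorem consErr_nonneg (P : Problem n d p Ξ) : 0 ≤ P.consErr :=
  Finset.sum_nonneg fun _ _ => by positivity

theorem gradSq_nonneg (P : Problem n d p Ξ) : 0 ≤ P.gradSq :=
  Finset.sum_nonneg fun _ _ => by positivity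

theorem Assumptions.gam_parts_pos (h : P.Assumptions) :
    0 < 120 * √3 * P.kappa * P.L / (1 - P.lam ^ 2) ^ 2 ∧
    0 < 72 * √6 * P.kappa ^ 2 * (P.L + P.mu) / √(1 - P.lam ^ 2) ∧
    0 < 110 * P.kappa ^ (5 / 4 : ℝ) * P.L / (1 - P.lam ^ 2) ^ (9 / 8 : ℝ) := by
  have hs := h.gapSq_pos
  have hk := h.kappa_pos
  have hL := h.L_pos
  have hm := h.mu_pos
  have := Real.sqrt_pos.2 hs
  refine ⟨by positivity, by positivity, by positivity⟩

theorem Assumptions.gam_pos (h : P.Assumptions) : 0 < P.gam := by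
  obtain ⟨h1, h2, h3⟩ := h.gam_parts_pos
  unfold gam
  linarith

theorem Assumptions.etaX_pos (h : P.Assumptions) : 0 < P.etaX := one_div_pos.2 h.gam_pos

theorem Assumptions.etaX_mul_gam (h : P.Assumptions) : P.etaX * P.gam = 1 :=
  one_div_mul_cancel h.gam_pos.ne'

/-- The first two summands of `γ` are each a lower bound for it; these are the two smallness
conditions that close the system. -/
theorem Assumptions.etaX_mul_le (h : P.Assumptions) :
    P.etaX * (120 * √3 * (P.L / P.mu) * P.L) ≤ (1 - P.lam ^ 2) ^ 2 ∧
    P.etaX * (72 * √6 * (P.L / P.mu) ^ 2 * (P.L + P.mu)) ≤ √(1 - P.lam ^ 2) := by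
  obtain ⟨h1, h2, h3⟩ := h.gam_parts_pos
  have hs := h.gapSq_pos
  have hr := Real.sqrt_pos.2 hs
  change P.etaX * (120 * √3 * P.kappa * P.L) ≤ _ ∧
    P.etaX * (72 * √6 * P.kappa ^ 2 * (P.L + P.mu)) ≤ _
  rw [etaX, one_div_mul_eq_div, one_div_mul_eq_div, div_le_iff₀ h.gam_pos, div_le_iff₀ h.gam_pos,
    ← div_le_iff₀' (by positivity), ← div_le_iff₀' hr]
  unfold gam
  constructor <;> linarith

theorem Assumptions.etaY_pos (h : P.Assumptions) : 0 < P.etaY := by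
  have hr := Real.sqrt_pos.2 h.gapSq_pos
  have hL := h.L_pos
  have hm := h.mu_pos
  unfold etaY
  positivity

theorem Assumptions.etaY_mul_L_le (h : P.Assumptions) : P.etaY * P.L ≤ 1 / 9 := by
  have hL := h.L_pos
  have hm := h.mu_pos
  have hr : √(1 - P.lam ^ 2) ≤ 1 := Real.sqrt_le_one.2 (by nlinarith [sq_nonneg P.lam])
  rw [etaY, div_mul_eq_mul_div, div_le_iff₀ (by positivity)]
  have : √(1 - P.lam ^ 2) * P.L ≤ 1 * P.L := by gcongr
  linarith

/-- Converts `1 - λ²` into `1 - λ`. The constant covers `240 + 110` and `360 + 110`, the `110`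
coming from the third summand. -/
theorem Assumptions.gam_le (h : P.Assumptions) :
    P.gam ≤ 500 * (P.kappa * P.L / (1 - P.lam) ^ 2 + P.kappa ^ 2 * P.L / √(1 - P.lam)) := by
  have hs := h.gapSq_pos
  have hs1 := h.one_sub_lam_pos
  have hL := h.L_pos
  have hm := h.mu_pos
  have hk := h.kappa_pos
  have hr := Real.sqrt_pos.2 hs
  have hr1 := Real.sqrt_pos.2 hs1
  have hle := h.one_sub_lam_le
  have h3 : √3 ≤ 2 := by rw [Real.sqrt_le_left (by norm_num)]; norm_num
  have h6 : √6 ≤ 5 / 2 := by rw [Real.sqrt_le_left (by norm_num)]; norm_num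
  have b1 : P.kappa * P.L / (1 - P.lam ^ 2) ^ 2 ≤ P.kappa * P.L / (1 - P.lam) ^ 2 := by gcongr
  have b2 : P.kappa ^ 2 * P.L / √(1 - P.lam ^ 2) ≤ P.kappa ^ 2 * P.L / √(1 - P.lam) := by gcongr
  have c1 : 120 * √3 * P.kappa * P.L / (1 - P.lam ^ 2) ^ 2
      ≤ 240 * (P.kappa * P.L / (1 - P.lam ^ 2) ^ 2) := by
    calc _ = 120 * √3 * (P.kappa * P.L / (1 - P.lam ^ 2) ^ 2) := by ring
      _ ≤ 120 * 2 * (P.kappa * P.L / (1 - P.lam ^ 2) ^ 2) := by gcongr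
      _ = _ := by ring
  have c2 : 72 * √6 * P.kappa ^ 2 * (P.L + P.mu) / √(1 - P.lam ^ 2)
      ≤ 360 * (P.kappa ^ 2 * P.L / √(1 - P.lam ^ 2)) := by
    calc _ ≤ 72 * (5 / 2) * P.kappa ^ 2 * (P.L + P.L) / √(1 - P.lam ^ 2) := by
          gcongr
          exact h.mu_le_L
      _ = _ := by ring
  have c3 : 110 * P.kappa ^ (5 / 4 : ℝ) * P.L / (1 - P.lam ^ 2) ^ (9 / 8 : ℝ)
      ≤ 110 * (P.kappa * P.L / (1 - P.lam ^ 2) ^ 2 + P.kappa ^ 2 * P.L / √(1 - P.lam ^ 2)) := by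
    have := rpow_div_rpow_le h.one_le_kappa hs (by nlinarith [sq_nonneg P.lam])
    calc _ = 110 * P.L * (P.kappa ^ (5 / 4 : ℝ) / (1 - P.lam ^ 2) ^ (9 / 8 : ℝ)) := by ring
      _ ≤ 110 * P.L * (P.kappa / (1 - P.lam ^ 2) ^ 2 + P.kappa ^ 2 / √(1 - P.lam ^ 2)) := by
          gcongr
      _ = _ := by ring
  unfold gam
  have p1 : 0 < P.kappa * P.L / (1 - P.lam) ^ 2 := by positivity
  have p2 : 0 < P.kappa ^ 2 * P.L / √(1 - P.lam) := by positivity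
  linarith

theorem Assumptions.trackErr_init_le (h : P.Assumptions) {b : ℕ}
    (s : (i : Fin n) → Fin b → Ξ i) : P.trackErr (P.init s) ≤ n * P.D ^ 2 := by
  have : ∀ i ∈ Finset.univ, ‖(P.init s).y i - P.argmax i (avg (P.init s).x)‖ ^ 2 ≤ P.D ^ 2 :=
    fun i _ => by
      gcongr
      exact h.constraint.dist_le (h.constraint.y0_mem i) (h.argmax_mem i _)
  simpa [trackErr] using Finset.sum_le_sum this

theorem Assumptions.disagreement_g_init_le (h : P.Assumptions) {b : ℕ}
    (s : (i : Fin n) → Fin b → Ξ i) :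
    disagreement (P.init s).g ≤ 2 * P.gradSq + 2 * P.noiseSq (P.init s) := by
  refine (sum_norm_sq_sub_avg_le h.network.card_ne_zero _).trans ?_
  rw [gradSq, noiseSq, Finset.mul_sum, Finset.mul_sum, ← Finset.sum_add_distrib]
  refine Finset.sum_le_sum fun i _ => ?_
  have e : (P.init s).g i = (P.grad i (P.x0 i) (P.y0 i)).fst + (P.noise (P.init s) i).fst := by
    simp [noise, init]
  rw [e]
  refine (norm_add_sq_le_two _ _).trans ?_
  gcongr
  exact WithLp.norm_fst_le _ _

/-- Coefficient of the noise correlations in `y`. -/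
def ascentWeight (P : Problem n d p Ξ) : ℝ :=
  (16 + (8 + 56 / 225) * (P.etaY * P.mu)) * (P.L ^ 2 / (P.mu * n))

-- The constant `1000 = 2 · 500` comes from `gam_le`, and `12 = 10 + 2` includes the noise in the
-- initial trackers. The two correlation sums carry deterministic weights, so they disappear under
-- expectation.
set_option maxHeartbeats 2000000 in
theorem Assumptions.sum_norm_sq_gradPhi_le (h : P.Assumptions) {b : ℕ}
    (s : ℕ → (i : Fin n) → Fin b → Ξ i) (k : ℕ) :
    ∑ t ∈ Finset.range (k + 1), ‖P.gradPhi (avg (P.run P.etaX P.etaY s t).x)‖ ^ 2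
      ≤ 1000 * P.rate
        + 12 * (P.kappa / n * ∑ t ∈ Finset.range (k + 1), P.noiseSq (P.run P.etaX P.etaY s t))
        + P.ascentWeight * ∑ t ∈ Finset.range (k + 1), P.ascentCross (P.run P.etaX P.etaY s t)
        - 2 * ∑ t ∈ Finset.range (k + 1), P.descentCross (P.run P.etaX P.etaY s t) := by
  have hs := h.gapSq_pos
  have hs1 := h.one_sub_lam_pos
  have hL := h.L_pos
  have hm := h.mu_pos
  have hk := h.kappa_pos
  have hn := h.card_pos
  have hηx := h.etaX_pos
  have hηy := h.etaY_pos
  obtain ⟨st, hst⟩ : ∃ st, st = P.run P.etaX P.etaY s := ⟨_, rfl⟩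
  have hc : ∀ t, P.Consistent (st t) := fun t => hst ▸ h.consistent_run s t
  have hstep : ∀ t, st (t + 1) = P.step P.etaX P.etaY (s (t + 1)) (st t) := fun t => by
    rw [hst]
    rfl
  have hE0 : P.noiseSq (st 0) ≤ ∑ t ∈ Finset.range (k + 1), P.noiseSq (st t) :=
    Finset.single_le_sum (f := fun t => P.noiseSq (st t)) (fun t _ => P.noiseSq_nonneg _)
      (Finset.mem_range.2 k.succ_pos)
  have hEs : 0 ≤ ∑ t ∈ Finset.range (k + 1), P.noiseSq (st t) :=
    Finset.sum_nonneg fun t _ => P.noiseSq_nonneg _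
  have hG0 : disagreement (st 0).g ≤ 2 * P.gradSq + 2 * P.noiseSq (st 0) :=
    hst ▸ h.disagreement_g_init_le _
  have hD0 : P.trackErr (st 0) ≤ n * P.D ^ 2 := hst ▸ h.trackErr_init_le _
  have hX0 : disagreement (st 0).x = P.consErr := by rw [hst]; rfl
  have hΦ0 : P.Phi (avg (st 0).x) - P.PhiStar = P.gap := by rw [hst]; rfl
  rw [← hst]
  have key := sum_norm_sq_grad_le_of_recursions (L := P.L) (μ := P.mu) (s := 1 - P.lam ^ 2)
    (ηx := P.etaX) (ηy := P.etaY) (γ := P.gam) (n := n) (Φs := P.PhiStar)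
    (X := fun t => disagreement (st t).x) (G := fun t => disagreement (st t).g)
    (Y := fun t => P.trackErr (st t))
    (D := fun t => ∑ i, ‖(st (t + 1)).y i - P.argmax i (avg (st t).x)‖ ^ 2)
    (S := fun t => ∑ i, ‖(st (t + 1)).y i - (st t).y i‖ ^ 2)
    (H := fun t => ∑ i, ‖((st (t + 1)).h i).fst - ((st t).h i).fst‖ ^ 2)
    (Q := fun t => ‖avg (st t).g‖ ^ 2) (M := fun t => P.meanSq (st t))
    (E := fun t => P.noiseSq (st t)) (F := fun t => ‖P.gradPhi (avg (st t).x)‖ ^ 2)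
    (c := fun t => P.ascentCross (st t)) (q := fun t => P.descentCross (st t))
    (Φ := fun t => P.Phi (avg (st t).x))
    hm h.mu_le_L hs (by nlinarith [sq_nonneg P.lam]) hn hηx rfl h.etaX_mul_gam h.etaX_mul_le.1
    h.etaX_mul_le.2 (fun t => disagreement_nonneg _) (fun t => disagreement_nonneg _)
    (fun t => P.trackErr_nonneg _) (fun t => Finset.sum_nonneg fun _ _ => by positivity)
    (fun t => Finset.sum_nonneg fun _ _ => by positivity) (fun t => sq_nonneg _)
    (fun t => sq_nonneg _) (fun t => P.noiseSq_nonneg _) (fun t => h.lowerBound _)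
    (fun t => by simp only [hstep]; exact h.disagreement_x_step_le _)
    (fun t => by simp only [hstep]; exact h.disagreement_g_step_le _)
    (fun t => by simp only [hstep]; exact h.sum_norm_sq_h_step_sub_le _ (hc t))
    (fun t => by simp only [hstep]; exact h.ascent_sum_le _ (hc t) hηy h.etaY_mul_L_le)
    (fun t => by
      simp only [hstep]
      exact h.trackErr_step_le _ (mul_pos hηy hm))
    (fun t => h.norm_sq_avg_g_le (hc t))
    (fun t => by simp only [hstep]; exact h.phi_step_le _ (hc t) hηx) k
  simp only [hX0, hΦ0] at key
  refine key.trans ?_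
  have hle := h.one_sub_lam_le
  have hr1 := Real.sqrt_pos.2 hs1
  have f1 : P.gap * P.gam ≤ 500 * (P.gap * P.kappa * P.L / (1 - P.lam) ^ 2
      + P.gap * P.kappa ^ 2 * P.L / √(1 - P.lam)) := by
    refine (mul_le_mul_of_nonneg_left h.gam_le h.gap_nonneg).trans_eq ?_
    ring
  have f2 : (P.L / P.mu) ^ 2 * P.L ^ 2 * P.consErr / (n * (1 - P.lam ^ 2))
      ≤ P.kappa ^ 2 * P.L ^ 2 * P.consErr / (n * (1 - P.lam)) := by
    have := P.consErr_nonneg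
    rw [kappa]
    gcongr
  have f3 : P.trackErr (st 0) * (P.L / P.mu) * P.L ^ 2 / (n * √(1 - P.lam ^ 2))
      ≤ P.D ^ 2 * P.kappa * P.L ^ 2 / √(1 - P.lam) := by
    calc _ ≤ n * P.D ^ 2 * (P.L / P.mu) * P.L ^ 2 / (n * √(1 - P.lam)) := by gcongr
      _ = _ := by rw [kappa]; field_simp
  have f4 : disagreement (st 0).g / n ≤ 2 * (P.gradSq / n)
      + 2 * (P.kappa / n * ∑ t ∈ Finset.range (k + 1), P.noiseSq (st t)) := by
    have h1 : disagreement (st 0).g / n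
        ≤ (2 * P.gradSq + 2 * ∑ t ∈ Finset.range (k + 1), P.noiseSq (st t)) / n := by
      gcongr
      linarith
    have h2 : 0 ≤ (∑ t ∈ Finset.range (k + 1), P.noiseSq (st t)) / n :=
      div_nonneg hEs hn.le
    have h3 := le_mul_of_one_le_left h2 h.one_le_kappa
    have e1 : P.kappa / n * ∑ t ∈ Finset.range (k + 1), P.noiseSq (st t)
      = P.kappa * ((∑ t ∈ Finset.range (k + 1), P.noiseSq (st t)) / n) := by ring
    rw [e1]
    rw [add_div, mul_div_assoc, mul_div_assoc] at h1
    linarith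
  have g1 : 0 ≤ P.kappa ^ 2 * P.L ^ 2 * P.consErr / (n * (1 - P.lam)) := by
    have := P.consErr_nonneg
    positivity
  have g2 : 0 ≤ P.D ^ 2 * P.kappa * P.L ^ 2 / √(1 - P.lam) := by positivity
  have g3 : 0 ≤ P.gradSq / n := div_nonneg P.gradSq_nonneg hn.le
  have e1 : P.L / P.mu * (∑ t ∈ Finset.range (k + 1), P.noiseSq (st t)) / n
      = P.kappa / n * ∑ t ∈ Finset.range (k + 1), P.noiseSq (st t) := by
    rw [kappa]
    ring
  rw [e1]
  unfold rate ascentWeight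
  linarith

end Problem

/-! ### Integrability and conditioning on independent samples -/

theorem integrable_inner_of_memLp {Ω E : Type*} [MeasurableSpace Ω] [NormedAddCommGroup E]
    [InnerProductSpace ℝ E] {μ : Measure Ω} {f g : Ω → E} (hf : MemLp f 2 μ) (hg : MemLp g 2 μ) :
    Integrable (fun ω => ⟪f ω, g ω⟫) μ := by
  refine Integrable.mono' ((hf.integrable_norm_pow two_ne_zero).add
    (hg.integrable_norm_pow two_ne_zero)) (hf.1.inner hg.1) (.of_forall fun ω => ?_)
  refine (norm_inner_le_norm _ _).trans ?_
  simp only [Pi.add_apply]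
  nlinarith [sq_nonneg (‖f ω‖ - ‖g ω‖), sq_nonneg ‖f ω‖, sq_nonneg ‖g ω‖]

namespace Problem

variable {n d : ℕ} {p : Fin n → ℕ} {Ξ : Fin n → Type u} [∀ i, MeasurableSpace (Ξ i)]
  {P : Problem n d p Ξ}

theorem Assumptions.proj_mem (h : P.Assumptions) (i : Fin n) (y : Vec (p i)) :
    proj (P.Y i) y ∈ P.Y i := (proj_spec (h.constraint.compact i) (h.constraint.nonempty i) y).1

theorem Assumptions.measurable_proj (h : P.Assumptions) (i : Fin n) :
    Measurable (proj (P.Y i)) :=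
  (continuous_proj (h.constraint.convex i) (h.constraint.compact i)
    (h.constraint.nonempty i)).measurable

theorem Assumptions.measurable_grad_proj (h : P.Assumptions) (i : Fin n) :
    Measurable fun q : Vec d × Vec (p i) => P.grad i q.1 (proj (P.Y i) q.2) := by
  refine Continuous.measurable (continuous_iff_continuousAt.2 fun q => ?_)
  have hc := continuous_proj (h.constraint.convex i) (h.constraint.compact i)
    (h.constraint.nonempty i)
  have h1 : Continuous fun q' : Vec d × Vec (p i) =>
      P.L * (‖q'.1 - q.1‖ + ‖proj (P.Y i) q'.2 - proj (P.Y i) q.2‖) := by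
    fun_prop
  refine tendsto_iff_norm_sub_tendsto_zero.2 (squeeze_zero (fun _ => norm_nonneg _)
    (fun q' => h.objective.smooth i _ _ _ (h.proj_mem i _) _ (h.proj_mem i _)) ?_)
  simpa using h1.tendsto q

/-- Error of one oracle answer. The point is projected first, which changes nothing for feasible
points and makes the function jointly measurable. -/
def oracleErr (P : Problem n d p Ξ) (i : Fin n) (x : Vec d) (y : Vec (p i)) (s : Ξ i) :
    Pair d (p i) :=
  P.oracle i x (proj (P.Y i) y) s - P.grad i x (proj (P.Y i) y)

theorem Assumptions.oracleErr_eq (h : P.Assumptions) {i : Fin n} (x : Vec d) {y : Vec (p i)}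
    (hy : y ∈ P.Y i) (s : Ξ i) :
    P.oracleErr i x y s = P.oracle i x y s - P.grad i x y := by
  rw [oracleErr, proj_eq_self (h.constraint.compact i) hy]

theorem Assumptions.measurable_oracleErr (h : P.Assumptions) (i : Fin n) :
    Measurable fun q : (Vec d × Vec (p i)) × Ξ i => P.oracleErr i q.1.1 q.1.2 q.2 := by
  have h1 : Measurable fun q : (Vec d × Vec (p i)) × Ξ i =>
      (q.1.1, proj (P.Y i) q.1.2, q.2) :=
    (measurable_fst.comp measurable_fst).prodMk
      (((h.measurable_proj i).comp (measurable_snd.comp measurable_fst)).prodMk measurable_snd)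
  exact ((h.oracle.meas i).comp h1).sub ((h.measurable_grad_proj i).comp measurable_fst)

theorem Assumptions.integrable_oracleErr_sq (h : P.Assumptions) (i : Fin n) (x : Vec d)
    (y : Vec (p i)) : Integrable (fun s => ‖P.oracleErr i x y s‖ ^ 2) (P.law i) :=
  h.oracle.integrable i x _ (h.proj_mem i y)

theorem Assumptions.memLp_oracleErr (h : P.Assumptions) (i : Fin n) (x : Vec d) (y : Vec (p i)) :
    MemLp (P.oracleErr i x y) 2 (P.law i) := by
  have hm : Measurable (P.oracleErr i x y) :=
    (h.measurable_oracleErr i).comp (measurable_const (a := (x, y)) |>.prodMk measurable_id)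
  exact (memLp_two_iff_integrable_sq_norm hm.aestronglyMeasurable).2
    (h.integrable_oracleErr_sq i x y)

theorem Assumptions.integral_oracleErr (h : P.Assumptions) (i : Fin n) (x : Vec d)
    (y : Vec (p i)) : ∫ s, P.oracleErr i x y s ∂(P.law i) = 0 := by
  have := h.oracle.prob i
  have h1 : Integrable (P.oracleErr i x y) (P.law i) :=
    (h.memLp_oracleErr i x y).integrable one_le_two
  have h2 : Integrable (P.oracle i x (proj (P.Y i) y)) (P.law i) := by
    have := h1.add (integrable_const (P.grad i x (proj (P.Y i) y)))
    refine this.congr (.of_forall fun s => ?_)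
    simp [oracleErr]
  change ∫ s, (P.oracle i x (proj (P.Y i) y) s - P.grad i x (proj (P.Y i) y)) ∂(P.law i) = 0
  rw [integral_sub h2 (integrable_const _), h.oracle.unbiased i x _ (h.proj_mem i y)]
  simp

section Independent

variable {Ω : Type v} {m mΩ : MeasurableSpace Ω} {Pr : Measure Ω} [IsProbabilityMeasure Pr]
  {i : Fin n} {V : Ω → Ξ i} {x : Ω → Vec d} {y : Ω → Vec (p i)}

/-- Replaces conditional expectations: a past-measurable `U` and a fresh sample have a product law,
so Tonelli and Fubini allow integrating the sample first with `U` frozen. -/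
theorem map_prod_eq_prod_law (hm : m ≤ mΩ) (hV : Measurable V)
    (hlaw : Pr.map V = P.law i) (hind : Indep m (MeasurableSpace.comap V inferInstance) Pr)
    {γ : Type*} [MeasurableSpace γ] {U : Ω → γ} (hU : Measurable[m] U) :
    Pr.map (fun ω => (U ω, V ω)) = (Pr.map U).prod (P.law i) := by
  rw [← hlaw]
  refine IndepFun.map_prod_eq_prod_map_map (hU.mono hm le_rfl).aemeasurable hV.aemeasurable ?_
  rw [IndepFun_iff_Indep]
  exact indep_of_indep_of_le_left hind hU.comap_le

theorem Assumptions.memLp_oracleErr_comp (h : P.Assumptions) (hm : m ≤ mΩ) (hV : Measurable V)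
    (hlaw : Pr.map V = P.law i) (hind : Indep m (MeasurableSpace.comap V inferInstance) Pr)
    (hx : Measurable[m] x) (hy : Measurable[m] y) :
    MemLp (fun ω => P.oracleErr i (x ω) (y ω) (V ω)) 2 Pr ∧
      ∫ ω, ‖P.oracleErr i (x ω) (y ω) (V ω)‖ ^ 2 ∂Pr ≤ P.sigma ^ 2 := by
  have hprob := h.oracle.prob i
  have hU : Measurable[m] fun ω => (x ω, y ω) := hx.prodMk hy
  have hU' : Measurable fun ω => (x ω, y ω) := hU.mono hm le_rfl
  have hmap := map_prod_eq_prod_law hm hV hlaw hind hU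
  have := Measure.isProbabilityMeasure_map (μ := Pr) hU'.aemeasurable
  have hmeas : Measurable fun ω => P.oracleErr i (x ω) (y ω) (V ω) :=
    (h.measurable_oracleErr i).comp (hU'.prodMk hV)
  have hF : Measurable fun q : (Vec d × Vec (p i)) × Ξ i =>
      ENNReal.ofReal (‖P.oracleErr i q.1.1 q.1.2 q.2‖ ^ 2) :=
    ((h.measurable_oracleErr i).norm.pow_const 2).ennreal_ofReal
  have hle : ∫⁻ ω, ENNReal.ofReal (‖P.oracleErr i (x ω) (y ω) (V ω)‖ ^ 2) ∂Pr
      ≤ ENNReal.ofReal (P.sigma ^ 2) := by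
    have h1 := lintegral_map (μ := Pr) hF (hU'.prodMk hV)
    rw [hmap, lintegral_prod _ hF.aemeasurable] at h1
    rw [← h1]
    calc _ ≤ ∫⁻ _, ENNReal.ofReal (P.sigma ^ 2) ∂(Pr.map fun ω => (x ω, y ω)) := by
          refine lintegral_mono fun q => ?_
          rw [← ofReal_integral_eq_lintegral_ofReal (h.integrable_oracleErr_sq i q.1 q.2)
            (.of_forall fun s => sq_nonneg _)]
          exact ENNReal.ofReal_le_ofReal (h.oracle.variance i q.1 _ (h.proj_mem i q.2))
      _ = _ := by simp
  constructor
  · rw [memLp_two_iff_integrable_sq_norm hmeas.aestronglyMeasurable]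
    refine ⟨(hmeas.norm.pow_const 2).aestronglyMeasurable, ?_⟩
    rw [hasFiniteIntegral_iff_ofReal (.of_forall fun s => sq_nonneg _)]
    exact hle.trans_lt ENNReal.ofReal_lt_top
  · rw [integral_eq_lintegral_of_nonneg_ae (.of_forall fun s => sq_nonneg _)
      (hmeas.norm.pow_const 2).aestronglyMeasurable]
    exact ENNReal.toReal_le_of_le_ofReal (sq_nonneg _) hle

/-- For frozen `Z`, `x`, `y` the inner integral over the sample vanishes by unbiasedness. -/
theorem Assumptions.integral_inner_oracleErr (h : P.Assumptions) (hm : m ≤ mΩ) (hV : Measurable V)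
    (hlaw : Pr.map V = P.law i) (hind : Indep m (MeasurableSpace.comap V inferInstance) Pr)
    (hx : Measurable[m] x) (hy : Measurable[m] y) {Z : Ω → Pair d (p i)} (hZ : Measurable[m] Z)
    (hZ2 : MemLp Z 2 Pr) :
    ∫ ω, ⟪Z ω, P.oracleErr i (x ω) (y ω) (V ω)⟫ ∂Pr = 0 := by
  have hprob := h.oracle.prob i
  have hU : Measurable[m] fun ω => (Z ω, x ω, y ω) := hZ.prodMk (hx.prodMk hy)
  have hU' : Measurable fun ω => (Z ω, x ω, y ω) := hU.mono hm le_rfl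
  have hmap := map_prod_eq_prod_law hm hV hlaw hind hU
  have := Measure.isProbabilityMeasure_map (μ := Pr) hU'.aemeasurable
  have hF : Measurable fun q : (Pair d (p i) × Vec d × Vec (p i)) × Ξ i =>
      ⟪q.1.1, P.oracleErr i q.1.2.1 q.1.2.2 q.2⟫ :=
    (measurable_fst.comp measurable_fst).inner ((h.measurable_oracleErr i).comp
      ((measurable_snd.comp measurable_fst).prodMk measurable_snd))
  have hint := integrable_inner_of_memLp hZ2 (h.memLp_oracleErr_comp hm hV hlaw hind hx hy).1
  have hint' : Integrable (fun q : (Pair d (p i) × Vec d × Vec (p i)) × Ξ i =>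
      ⟪q.1.1, P.oracleErr i q.1.2.1 q.1.2.2 q.2⟫)
      ((Pr.map fun ω => (Z ω, x ω, y ω)).prod (P.law i)) := by
    rw [← hmap]
    exact (integrable_map_measure hF.aestronglyMeasurable (hU'.prodMk hV).aemeasurable).2 hint
  have h1 := integral_map (μ := Pr) (hU'.prodMk hV).aemeasurable
    (f := fun q : (Pair d (p i) × Vec d × Vec (p i)) × Ξ i =>
      ⟪q.1.1, P.oracleErr i q.1.2.1 q.1.2.2 q.2⟫) hF.aestronglyMeasurable
  rw [← h1, hmap, integral_prod _ hint']
  refine integral_eq_zero_of_ae (.of_forall fun q => ?_)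
  simp only [Pi.zero_apply]
  rw [integral_inner ((h.memLp_oracleErr i _ _).integrable one_le_two), h.integral_oracleErr,
    inner_zero_right]

end Independent

end Problem

theorem measurable_const_smul {Ω E : Type*} [MeasurableSpace Ω] [NormedAddCommGroup E]
    [NormedSpace ℝ E] [MeasurableSpace E] [BorelSpace E] {f : Ω → E} (hf : Measurable f) (c : ℝ) :
    Measurable fun ω => c • f ω := hf.const_smul c

theorem measurable_avg {n d : ℕ} {Ω : Type*} [MeasurableSpace Ω] {u : Ω → Fin n → Vec d}
    (hu : ∀ i, Measurable fun ω => u ω i) : Measurable fun ω => avg (u ω) :=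
  measurable_const_smul (Finset.univ.measurable_sum fun i _ => hu i) _

theorem memLp_const_smul {Ω E : Type*} [MeasurableSpace Ω] [NormedAddCommGroup E]
    [NormedSpace ℝ E] {μ : Measure Ω} {f : Ω → E} (hf : MemLp f 2 μ) (c : ℝ) :
    MemLp (fun ω => c • f ω) 2 μ := hf.const_smul c

theorem memLp_sum {Ω E ι : Type*} [Fintype ι] [MeasurableSpace Ω] [NormedAddCommGroup E]
    {μ : Measure Ω} {f : ι → Ω → E} (hf : ∀ i, MemLp (f i) 2 μ) :
    MemLp (fun ω => ∑ i, f i ω) 2 μ := by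
  simpa only [Finset.sum_apply] using memLp_finsetSum Finset.univ fun i _ => hf i

theorem memLp_avg {n d : ℕ} {Ω : Type*} [MeasurableSpace Ω] {μ : Measure Ω}
    {u : Ω → Fin n → Vec d} (hu : ∀ i, MemLp (fun ω => u ω i) 2 μ) :
    MemLp (fun ω => avg (u ω)) 2 μ :=
  memLp_const_smul (memLp_sum hu) _

theorem norm_avg_le {n d : ℕ} {u : Fin n → Vec d} {C : ℝ} (hC : 0 ≤ C) (hu : ∀ i, ‖u i‖ ≤ C) :
    ‖avg u‖ ≤ C := by
  rcases Nat.eq_zero_or_pos n with rfl | hn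
  · simpa [avg] using hC
  have hn' : (0 : ℝ) < n := by exact_mod_cast hn
  rw [avg, norm_smul, norm_inv, Real.norm_natCast, inv_mul_le_iff₀ hn']
  refine (norm_sum_le _ _).trans ((Finset.sum_le_sum fun i _ => hu i).trans_eq ?_)
  simp

namespace Problem

variable {n d : ℕ} {p : Fin n → ℕ} {Ξ : Fin n → Type u} [∀ i, MeasurableSpace (Ξ i)]
  {P : Problem n d p Ξ}

theorem Assumptions.norm_gradPhi_sub_le (h : P.Assumptions) (x x' : Vec d) :
    ‖P.gradPhi x - P.gradPhi x'‖ ≤ P.L * (1 + P.kappa) * ‖x - x'‖ := by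
  have hL := h.L_pos
  have hk := h.kappa_pos
  rw [gradPhi, gradPhi, ← avg_sub]
  refine norm_avg_le (by positivity) fun i => ?_
  rw [← WithLp.sub_fst]
  refine (WithLp.norm_fst_le _ _).trans ((h.objective.smooth i _ _ _ (h.argmax_mem i x) _
    (h.argmax_mem i x')).trans ?_)
  have := h.norm_argmax_sub_le i x x'
  calc _ ≤ P.L * (‖x - x'‖ + P.kappa * ‖x - x'‖) := by gcongr
    _ = _ := by ring

theorem Assumptions.continuous_gradPhi (h : P.Assumptions) : Continuous P.gradPhi := by
  have hL := h.L_pos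
  have hk := h.kappa_pos
  refine LipschitzWith.continuous (K := Real.toNNReal (P.L * (1 + P.kappa)))
    (LipschitzWith.of_dist_le_mul fun x x' => ?_)
  rw [dist_eq_norm, dist_eq_norm, Real.coe_toNNReal _ (by positivity)]
  exact h.norm_gradPhi_sub_le x x'

theorem Assumptions.continuous_argmax (h : P.Assumptions) (i : Fin n) :
    Continuous (P.argmax i) := by
  refine LipschitzWith.continuous (K := Real.toNNReal P.kappa)
    (LipschitzWith.of_dist_le_mul fun x x' => ?_)
  rw [dist_eq_norm, dist_eq_norm, Real.coe_toNNReal _ h.kappa_pos.le]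
  exact h.norm_argmax_sub_le i x x'

theorem Assumptions.measurable_miniBatch (h : P.Assumptions) {Ω : Type*} [MeasurableSpace Ω]
    {b : ℕ} {i : Fin n} {s : Ω → (i : Fin n) → Fin b → Ξ i} {x : Ω → Fin n → Vec d}
    {y : Ω → (i : Fin n) → Vec (p i)} (hs : ∀ j, Measurable fun ω => s ω i j)
    (hx : Measurable fun ω => x ω i) (hy : Measurable fun ω => y ω i) :
    Measurable fun ω => P.miniBatch (s ω) (x ω) (y ω) i :=
  measurable_const_smul (Finset.univ.measurable_sum fun j _ =>
    (h.oracle.meas i).comp (hx.prodMk (hy.prodMk (hs j)))) _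

theorem Assumptions.measurable_grad_proj_comp (h : P.Assumptions) {Ω : Type*} [MeasurableSpace Ω]
    {i : Fin n} {x : Ω → Vec d} {y : Ω → Vec (p i)} (hx : Measurable x) (hy : Measurable y) :
    Measurable fun ω => P.grad i (x ω) (proj (P.Y i) (y ω)) :=
  (h.measurable_grad_proj i).comp (hx.prodMk hy)

theorem measurable_mix {Ω : Type*} [MeasurableSpace Ω] {u : Ω → Fin n → Vec d}
    (hu : ∀ i, Measurable fun ω => u ω i) (i : Fin n) :
    Measurable fun ω => ∑ j, P.W i j • u ω j :=
  Finset.univ.measurable_sum fun j _ => measurable_const_smul (hu j) _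

/-! ### The sample filtration and the moments of the iterates -/

section Sampling

variable {b : ℕ} {Ω : Type v}
  {ξ : ℕ → (i : Fin n) → Fin b → Ω → Ξ i}

/-- The information carried by the samples with indices in `S`. -/
@[reducible] def sampleAlg (ξ : ℕ → (i : Fin n) → Fin b → Ω → Ξ i) (S : Set (ℕ × Fin n × Fin b)) :
    MeasurableSpace Ω :=
  ⨆ q ∈ S, MeasurableSpace.comap (ξ q.1 q.2.1 q.2.2) inferInstance

/-- The indices of the samples drawn before iterate `t` is evaluated. -/
def past (n b t : ℕ) : Set (ℕ × Fin n × Fin b) := {q | q.1 < t}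

theorem sampleAlg_mono {S T : Set (ℕ × Fin n × Fin b)} (hST : S ⊆ T) :
    sampleAlg ξ S ≤ sampleAlg ξ T := biSup_mono hST

theorem measurable_sample {S : Set (ℕ × Fin n × Fin b)} {t : ℕ} {i : Fin n} {j : Fin b}
    (hS : (t, i, j) ∈ S) : Measurable[sampleAlg ξ S] (ξ t i j) :=
  measurable_iff_comap_le.2 (le_biSup
    (fun q : ℕ × Fin n × Fin b => MeasurableSpace.comap (ξ q.1 q.2.1 q.2.2) inferInstance) hS)

/-- The iterates `x`, `y` at time `t` use only samples with time index below `t`, while `h` and `g`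
also use those of time `t`. This off-by-one is what makes the noise at time `t` independent of the
point where it is evaluated. -/
theorem Assumptions.measurable_iter (h : P.Assumptions)
    (ξ : ℕ → (i : Fin n) → Fin b → Ω → Ξ i) (t : ℕ) :
    (∀ i, Measurable[sampleAlg ξ (past n b t)] fun ω => (P.iter ξ t ω).x i) ∧
    (∀ i, Measurable[sampleAlg ξ (past n b t)] fun ω => (P.iter ξ t ω).y i) ∧
    (∀ i, Measurable[sampleAlg ξ (past n b (t + 1))] fun ω => (P.iter ξ t ω).h i) ∧
    (∀ i, Measurable[sampleAlg ξ (past n b (t + 1))] fun ω => (P.iter ξ t ω).g i) := by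
  have hsamp : ∀ t i j, Measurable[sampleAlg ξ (past n b (t + 1))] (ξ t i j) :=
    fun t i j => measurable_sample (Nat.lt_succ_self t)
  have hmono : ∀ t, sampleAlg ξ (past n b t) ≤ sampleAlg ξ (past n b (t + 1)) :=
    fun t => sampleAlg_mono fun q hq => Nat.lt_succ_of_lt hq
  induction t with
  | zero =>
    have hh : ∀ i, Measurable[sampleAlg ξ (past n b (0 + 1))] fun ω => (P.iter ξ 0 ω).h i :=
      fun i => @measurable_miniBatch _ _ _ _ _ P h Ω (sampleAlg ξ (past n b (0 + 1))) b i
        (fun ω i j => ξ 0 i j ω) (fun _ => P.x0) (fun _ => P.y0) (fun j => hsamp 0 i j)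
        measurable_const measurable_const
    exact ⟨fun i => measurable_const, fun i => measurable_const, hh,
      fun i => (WithLp.continuous_fst 2 _ _).measurable.comp (hh i)⟩
  | succ t ih =>
    obtain ⟨ihx, ihy, ihh, ihg⟩ := ih
    have hx : ∀ i, Measurable[sampleAlg ξ (past n b (t + 1))]
        fun ω => (P.iter ξ (t + 1) ω).x i := fun i => by
      let _ := sampleAlg ξ (past n b (t + 1))
      exact measurable_mix (P := P) (u := fun ω j => (P.iter ξ t ω).x j
        - P.etaX • (P.iter ξ t ω).g j) (fun j => ((ihx j).mono (hmono t) le_rfl).sub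
          (measurable_const_smul (ihg j) P.etaX)) i
    have hy : ∀ i, Measurable[sampleAlg ξ (past n b (t + 1))]
        fun ω => (P.iter ξ (t + 1) ω).y i := fun i => by
      let _ := sampleAlg ξ (past n b (t + 1))
      exact (h.measurable_proj i).comp (((ihy i).mono (hmono t) le_rfl).add
        (measurable_const_smul ((WithLp.continuous_snd 2 _ _).measurable.comp (ihh i)) P.etaY))
    have hh : ∀ i, Measurable[sampleAlg ξ (past n b (t + 1 + 1))]
        fun ω => (P.iter ξ (t + 1) ω).h i := fun i => by
      let _ := sampleAlg ξ (past n b (t + 1 + 1))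
      exact h.measurable_miniBatch (s := fun ω i j => ξ (t + 1) i j ω)
        (x := fun ω => (P.iter ξ (t + 1) ω).x) (y := fun ω => (P.iter ξ (t + 1) ω).y)
        (fun j => hsamp (t + 1) i j) ((hx i).mono (hmono _) le_rfl) ((hy i).mono (hmono _) le_rfl)
    refine ⟨hx, hy, hh, fun i => ?_⟩
    let _ := sampleAlg ξ (past n b (t + 1 + 1))
    exact measurable_mix (P := P) (u := fun ω j => (P.iter ξ t ω).g j
      + ((P.iter ξ (t + 1) ω).h j).fst - ((P.iter ξ t ω).h j).fst)
      (fun j => (((ihg j).mono (hmono _) le_rfl).add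
        ((WithLp.continuous_fst 2 _ _).measurable.comp (hh j))).sub
        ((WithLp.continuous_fst 2 _ _).measurable.comp ((ihh j).mono (hmono _) le_rfl))) i

theorem Assumptions.consistent_iter (h : P.Assumptions)
    (ξ : ℕ → (i : Fin n) → Fin b → Ω → Ξ i) (t : ℕ) (ω : Ω) : P.Consistent (P.iter ξ t ω) :=
  h.consistent_run _ t

theorem Assumptions.noise_iter (h : P.Assumptions) (hb : b ≠ 0)
    (ξ : ℕ → (i : Fin n) → Fin b → Ω → Ξ i) (t : ℕ) (ω : Ω) (i : Fin n) :
    P.noise (P.iter ξ t ω) i = (b : ℝ)⁻¹ • ∑ j,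
      P.oracleErr i ((P.iter ξ t ω).x i) ((P.iter ξ t ω).y i) (ξ t i j ω) := by
  have hb' : (b : ℝ) ≠ 0 := by exact_mod_cast hb
  have h1 : (P.iter ξ t ω).h i = (b : ℝ)⁻¹ • ∑ j,
      P.oracle i ((P.iter ξ t ω).x i) ((P.iter ξ t ω).y i) (ξ t i j ω) := by
    cases t <;> rfl
  simp only [h.oracleErr_eq _ ((h.consistent_iter ξ t ω).y_mem i), Finset.sum_sub_distrib, noise,
    h1, smul_sub]
  congr 1
  simp [← Nat.cast_smul_eq_nsmul ℝ, smul_smul, hb']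

variable {mΩ : MeasurableSpace Ω} {Pr : Measure Ω}

theorem IsSampling.sampleAlg_le (hs : P.IsSampling Pr ξ) (S : Set (ℕ × Fin n × Fin b)) :
    sampleAlg ξ S ≤ mΩ := iSup₂_le fun q _ => (hs.meas q.1 q.2.1 q.2.2).comap_le

theorem IsSampling.indep_sampleAlg (hs : P.IsSampling Pr ξ) {S : Set (ℕ × Fin n × Fin b)} {t : ℕ}
    {i : Fin n} {j : Fin b} (hS : (t, i, j) ∉ S) :
    Indep (sampleAlg ξ S) (MeasurableSpace.comap (ξ t i j) inferInstance) Pr := by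
  have h1 := indep_iSup_of_disjoint
    (m := fun q : ℕ × Fin n × Fin b => MeasurableSpace.comap (ξ q.1 q.2.1 q.2.2) inferInstance)
    (fun q => (hs.meas q.1 q.2.1 q.2.2).comap_le) hs.indep
    (S := S) (T := {(t, i, j)}) (Set.disjoint_singleton_right.2 hS)
  rwa [iSup_singleton] at h1

variable [IsProbabilityMeasure Pr]

theorem Assumptions.memLp_oracleErr_iter (h : P.Assumptions) (hs : P.IsSampling Pr ξ) (t : ℕ)
    (i : Fin n) (j : Fin b) :
    MemLp (fun ω => P.oracleErr i ((P.iter ξ t ω).x i) ((P.iter ξ t ω).y i) (ξ t i j ω)) 2 Pr ∧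
    ∫ ω, ‖P.oracleErr i ((P.iter ξ t ω).x i) ((P.iter ξ t ω).y i) (ξ t i j ω)‖ ^ 2 ∂Pr
      ≤ P.sigma ^ 2 := by
  obtain ⟨hx, hy, -, -⟩ := h.measurable_iter ξ t
  exact h.memLp_oracleErr_comp (hs.sampleAlg_le _) (hs.meas t i j) (hs.hasLaw t i j)
    (hs.indep_sampleAlg (S := past n b t) (lt_irrefl t)) (hx i) (hy i)

theorem Assumptions.integral_inner_oracleErr_iter (h : P.Assumptions) (hs : P.IsSampling Pr ξ)
    (t : ℕ) (i : Fin n) (j : Fin b) {S : Set (ℕ × Fin n × Fin b)} (hS : past n b t ⊆ S)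
    (hS' : (t, i, j) ∉ S) {Z : Ω → Pair d (p i)} (hZ : Measurable[sampleAlg ξ S] Z)
    (hZ2 : MemLp Z 2 Pr) :
    ∫ ω, ⟪Z ω, P.oracleErr i ((P.iter ξ t ω).x i) ((P.iter ξ t ω).y i) (ξ t i j ω)⟫ ∂Pr = 0 := by
  obtain ⟨hx, hy, -, -⟩ := h.measurable_iter ξ t
  exact h.integral_inner_oracleErr (hs.sampleAlg_le _) (hs.meas t i j) (hs.hasLaw t i j)
    (hs.indep_sampleAlg hS') ((hx i).mono (sampleAlg_mono hS) le_rfl)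
    ((hy i).mono (sampleAlg_mono hS) le_rfl) hZ hZ2

theorem Assumptions.memLp_noise (h : P.Assumptions) (hs : P.IsSampling Pr ξ) (hb : b ≠ 0) (t : ℕ)
    (i : Fin n) : MemLp (fun ω => P.noise (P.iter ξ t ω) i) 2 Pr := by
  simp only [h.noise_iter hb]
  exact memLp_const_smul (memLp_sum fun j => (h.memLp_oracleErr_iter hs t i j).1) _

theorem Assumptions.integral_inner_noise (h : P.Assumptions) (hs : P.IsSampling Pr ξ) (hb : b ≠ 0)
    (t : ℕ) (i : Fin n) {Z : Ω → Pair d (p i)} (hZ : Measurable[sampleAlg ξ (past n b t)] Z)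
    (hZ2 : MemLp Z 2 Pr) : ∫ ω, ⟪Z ω, P.noise (P.iter ξ t ω) i⟫ ∂Pr = 0 := by
  simp only [h.noise_iter hb, inner_smul_right, inner_sum]
  rw [integral_const_mul, integral_finsetSum _ fun j _ =>
    integrable_inner_of_memLp hZ2 (h.memLp_oracleErr_iter hs t i j).1]
  rw [Finset.sum_eq_zero fun j _ => h.integral_inner_oracleErr_iter hs t i j subset_rfl
    (lt_irrefl t) hZ hZ2, mul_zero]

/-- Expanding the square of the batch mean leaves `b` diagonal terms with prefactor `1/b²`, since
the errors within a batch are uncorrelated. -/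
theorem Assumptions.integral_norm_sq_noise_le (h : P.Assumptions) (hs : P.IsSampling Pr ξ)
    (hb : b ≠ 0) (t : ℕ) (i : Fin n) :
    ∫ ω, ‖P.noise (P.iter ξ t ω) i‖ ^ 2 ∂Pr ≤ P.sigma ^ 2 / b := by
  have hb' : (0 : ℝ) < b := by exact_mod_cast Nat.pos_of_ne_zero hb
  obtain ⟨ε, hε⟩ : ∃ ε : Fin b → Ω → Pair d (p i), ε = fun j ω =>
    P.oracleErr i ((P.iter ξ t ω).x i) ((P.iter ξ t ω).y i) (ξ t i j ω) := ⟨_, rfl⟩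
  have hL2 : ∀ j, MemLp (ε j) 2 Pr := fun j => hε ▸ (h.memLp_oracleErr_iter hs t i j).1
  have hint : ∀ j k, Integrable (fun ω => ⟪ε j ω, ε k ω⟫) Pr :=
    fun j k => integrable_inner_of_memLp (hL2 j) (hL2 k)
  have hcross : ∀ j k, k ≠ j → ∫ ω, ⟪ε j ω, ε k ω⟫ ∂Pr = 0 := fun j k hjk => by
    -- Sample `j` is adjoined to the past, so that the error of sample `j` becomes measurable while
    -- sample `k` remains independent.
    have hsub : past n b t ⊆ insert (t, i, j) (past n b t) := Set.subset_insert _ _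
    obtain ⟨hx, hy, -, -⟩ := h.measurable_iter ξ t
    have hm : Measurable[sampleAlg ξ (insert (t, i, j) (past n b t))] (ε j) := by
      let _ := sampleAlg ξ (insert (t, i, j) (past n b t))
      rw [hε]
      exact (h.measurable_oracleErr i).comp ((((hx i).mono (sampleAlg_mono hsub) le_rfl).prodMk
        ((hy i).mono (sampleAlg_mono hsub) le_rfl)).prodMk
          (measurable_sample (Set.mem_insert _ _)))
    have hnot : (t, i, k) ∉ insert (t, i, j) (past n b t) := by
      rintro (h1 | h1)
      · exact hjk (by simpa using h1)
      · exact lt_irrefl t h1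
    have := h.integral_inner_oracleErr_iter hs t i k hsub hnot hm (hL2 j)
    rw [hε] at this ⊢
    exact this
  have hdiag : ∀ j, ∫ ω, ⟪ε j ω, ε j ω⟫ ∂Pr ≤ P.sigma ^ 2 := fun j => by
    simp only [real_inner_self_eq_norm_sq]
    rw [hε]
    exact (h.memLp_oracleErr_iter hs t i j).2
  have hexp : ∀ ω, ‖P.noise (P.iter ξ t ω) i‖ ^ 2
      = ((b : ℝ)⁻¹) ^ 2 * ∑ j, ∑ k, ⟪ε j ω, ε k ω⟫ := fun ω => by
    rw [h.noise_iter hb, norm_smul, mul_pow, Real.norm_eq_abs, sq_abs,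
      ← real_inner_self_eq_norm_sq, sum_inner]
    simp only [inner_sum, hε]
  simp only [hexp]
  rw [integral_const_mul, integral_finsetSum _ fun j _ => integrable_finsetSum _ fun k _ => hint j k]
  have h1 : ∀ j ∈ Finset.univ, ∫ ω, ∑ k, ⟪ε j ω, ε k ω⟫ ∂Pr ≤ P.sigma ^ 2 := fun j _ => by
    rw [integral_finsetSum _ fun k _ => hint j k,
      Finset.sum_eq_single j (fun k _ hk => hcross j k hk) (by simp)]
    exact hdiag j
  calc _ ≤ ((b : ℝ)⁻¹) ^ 2 * ∑ _j : Fin b, P.sigma ^ 2 := by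
        gcongr with j hj
        exact h1 j hj
    _ = _ := by
        simp
        field_simp

/-- Induction on `t`: gradients grow at most linearly in `x` because `Y i` is bounded, and the noise
is square integrable. -/
theorem Assumptions.memLp_iter (h : P.Assumptions) (hs : P.IsSampling Pr ξ) (hb : b ≠ 0) (t : ℕ) :
    (∀ i, MemLp (fun ω => (P.iter ξ t ω).x i) 2 Pr) ∧
    (∀ i, MemLp (fun ω => (P.iter ξ t ω).h i) 2 Pr) ∧
    (∀ i, MemLp (fun ω => (P.iter ξ t ω).g i) 2 Pr) := by
  have hL := h.L_pos
  have hh : ∀ t, (∀ i, MemLp (fun ω => (P.iter ξ t ω).x i) 2 Pr) →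
      ∀ i, MemLp (fun ω => (P.iter ξ t ω).h i) 2 Pr := fun t hx i => by
    obtain ⟨mx, my, -, -⟩ := h.measurable_iter ξ t
    have mx' : Measurable fun ω => (P.iter ξ t ω).x i :=
      (mx i).mono (hs.sampleAlg_le (past n b t)) le_rfl
    have my' : Measurable fun ω => (P.iter ξ t ω).y i :=
      (my i).mono (hs.sampleAlg_le (past n b t)) le_rfl
    have hg : MemLp (fun ω => P.grad i ((P.iter ξ t ω).x i) ((P.iter ξ t ω).y i)) 2 Pr := by
      have hc : MemLp (fun _ : Ω => ‖P.grad i 0 (P.y0 i)‖ + P.L * P.D) 2 Pr := memLp_const _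
      have hx' : MemLp (fun ω => P.L * ‖(P.iter ξ t ω).x i‖) 2 Pr := (hx i).norm.const_mul P.L
      have hbd : MemLp (fun ω => (‖P.grad i 0 (P.y0 i)‖ + P.L * P.D)
        + P.L * ‖(P.iter ξ t ω).x i‖) 2 Pr := hc.add hx'
      refine hbd.of_le ?_ (.of_forall fun ω => ?_)
      · have h1 : Measurable fun ω => P.grad i ((P.iter ξ t ω).x i)
            (proj (P.Y i) ((P.iter ξ t ω).y i)) :=
          h.measurable_grad_proj_comp (x := fun ω => (P.iter ξ t ω).x i)
            (y := fun ω => (P.iter ξ t ω).y i) mx' my'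
        have h2 : ∀ ω, proj (P.Y i) ((P.iter ξ t ω).y i) = (P.iter ξ t ω).y i := fun ω =>
          proj_eq_self (h.constraint.compact i) ((h.consistent_iter ξ t ω).y_mem i)
        simp only [h2] at h1
        exact h1.aestronglyMeasurable
      · have h1 := h.objective.smooth i ((P.iter ξ t ω).x i) 0 _
          ((h.consistent_iter ξ t ω).y_mem i) _ (h.constraint.y0_mem i)
        have h2 := h.constraint.dist_le ((h.consistent_iter ξ t ω).y_mem i) (h.constraint.y0_mem i)
        have h3 := norm_le_norm_add_norm_sub' (P.grad i ((P.iter ξ t ω).x i) ((P.iter ξ t ω).y i))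
          (P.grad i 0 (P.y0 i))
        rw [sub_zero] at h1
        have h4 := mul_le_mul_of_nonneg_left h2 hL.le
        refine le_trans ?_ (le_abs_self _)
        linarith
    refine ((h.memLp_noise hs hb t i).add hg).ae_eq (.of_forall fun ω => ?_)
    simp [noise]
  induction t with
  | zero =>
    have hx : ∀ i, MemLp (fun ω => (P.iter ξ 0 ω).x i) 2 Pr := fun i => memLp_const (P.x0 i)
    exact ⟨hx, hh 0 hx, fun i => (hh 0 hx i).of_le_mul (c := 1)
      ((WithLp.continuous_fst 2 _ _).comp_aestronglyMeasurable (hh 0 hx i).1)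
      (.of_forall fun ω => by rw [one_mul]; exact WithLp.norm_fst_le _ _)⟩
  | succ t ih =>
    obtain ⟨ihx, ihh, ihg⟩ := ih
    have hx : ∀ i, MemLp (fun ω => (P.iter ξ (t + 1) ω).x i) 2 Pr := fun i =>
      memLp_sum fun j =>
        memLp_const_smul ((ihx j).sub (memLp_const_smul (ihg j) P.etaX)) (P.W i j)
    have h1 := hh (t + 1) hx
    have hf : ∀ {k : ℕ} {u : Ω → Pair d k}, MemLp u 2 Pr → MemLp (fun ω => (u ω).fst) 2 Pr :=
      fun hu => hu.of_le ((WithLp.continuous_fst 2 _ _).comp_aestronglyMeasurable hu.1)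
        (.of_forall fun ω => WithLp.norm_fst_le _ _)
    exact ⟨hx, h1, fun i => memLp_sum fun j =>
      memLp_const_smul (((ihg j).add (hf (h1 j))).sub (hf (ihh j))) (P.W i j)⟩

end Sampling

/-! ### Taking expectations -/

section Expectation

variable {b : ℕ} {Ω : Type v} {mΩ : MeasurableSpace Ω} {Pr : Measure Ω}
  {ξ : ℕ → (i : Fin n) → Fin b → Ω → Ξ i} [IsProbabilityMeasure Pr]

theorem Assumptions.measurable_gradPhi_iter (h : P.Assumptions)
    (ξ : ℕ → (i : Fin n) → Fin b → Ω → Ξ i) (t : ℕ) :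
    Measurable[sampleAlg ξ (past n b t)] fun ω => P.gradPhi (avg (P.iter ξ t ω).x) := by
  let _ := sampleAlg ξ (past n b t)
  exact h.continuous_gradPhi.measurable.comp (measurable_avg (h.measurable_iter ξ t).1)

theorem Assumptions.measurable_sub_argmax_iter (h : P.Assumptions)
    (ξ : ℕ → (i : Fin n) → Fin b → Ω → Ξ i) (t : ℕ) (i : Fin n) :
    Measurable[sampleAlg ξ (past n b t)]
      fun ω => (P.iter ξ t ω).y i - P.argmax i (avg (P.iter ξ t ω).x) := by
  let _ := sampleAlg ξ (past n b t)
  exact ((h.measurable_iter ξ t).2.1 i).sub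
    ((h.continuous_argmax i).measurable.comp (measurable_avg (h.measurable_iter ξ t).1))

theorem Assumptions.memLp_gradPhi_iter (h : P.Assumptions) (hs : P.IsSampling Pr ξ) (hb : b ≠ 0)
    (t : ℕ) : MemLp (fun ω => P.gradPhi (avg (P.iter ξ t ω).x)) 2 Pr := by
  have hL := h.L_pos
  have hk := h.kappa_pos
  have hx : MemLp (fun ω => P.L * (1 + P.kappa) * ‖avg (P.iter ξ t ω).x‖) 2 Pr :=
    (memLp_avg (h.memLp_iter hs hb t).1).norm.const_mul _
  have hc : MemLp (fun _ : Ω => ‖P.gradPhi 0‖) 2 Pr := memLp_const _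
  have hbd : MemLp (fun ω => ‖P.gradPhi 0‖ + P.L * (1 + P.kappa) * ‖avg (P.iter ξ t ω).x‖) 2 Pr :=
    hc.add hx
  refine hbd.of_le ((h.measurable_gradPhi_iter ξ t).mono (hs.sampleAlg_le (past n b t))
    le_rfl).aestronglyMeasurable (.of_forall fun ω => ?_)
  refine le_trans ?_ (le_abs_self _)
  have h1 := h.norm_gradPhi_sub_le (avg (P.iter ξ t ω).x) 0
  have h2 := norm_le_norm_add_norm_sub' (P.gradPhi (avg (P.iter ξ t ω).x)) (P.gradPhi 0)
  rw [sub_zero] at h1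
  linarith

theorem Assumptions.memLp_sub_argmax_iter (h : P.Assumptions) (hs : P.IsSampling Pr ξ)
    (t : ℕ) (i : Fin n) :
    MemLp (fun ω => (P.iter ξ t ω).y i - P.argmax i (avg (P.iter ξ t ω).x)) 2 Pr :=
  MemLp.of_bound ((h.measurable_sub_argmax_iter ξ t i).mono (hs.sampleAlg_le (past n b t))
    le_rfl).aestronglyMeasurable P.D (.of_forall fun ω =>
      h.constraint.dist_le ((h.consistent_iter ξ t ω).y_mem i) (h.argmax_mem i _))

theorem Assumptions.ascentCross_iter (h : P.Assumptions) (hs : P.IsSampling Pr ξ) (hb : b ≠ 0)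
    (t : ℕ) : Integrable (fun ω => P.ascentCross (P.iter ξ t ω)) Pr ∧
      ∫ ω, P.ascentCross (P.iter ξ t ω) ∂Pr = 0 := by
  -- The tracking error is padded by a zero `x`-block, so that pairing with the full noise sees only
  -- its `y`-block.
  obtain ⟨Z, hZ⟩ : ∃ Z : (i : Fin n) → Ω → Pair d (p i), Z = fun i ω => WithLp.toLp 2
    (0, (P.iter ξ t ω).y i - P.argmax i (avg (P.iter ξ t ω).x)) := ⟨_, rfl⟩
  have hZm : ∀ i, Measurable[sampleAlg ξ (past n b t)] (Z i) := fun i => by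
    let _ := sampleAlg ξ (past n b t)
    rw [hZ]
    exact (WithLp.measurable_toLp 2 _).comp
      (measurable_const.prodMk (h.measurable_sub_argmax_iter ξ t i))
  have hZ2 : ∀ i, MemLp (Z i) 2 Pr := fun i => by
    refine (h.memLp_sub_argmax_iter hs t i).of_le
      ((hZm i).mono (hs.sampleAlg_le (past n b t)) le_rfl).aestronglyMeasurable
      (.of_forall fun ω => ?_)
    rw [hZ, WithLp.norm_toLp_snd]
  have e : ∀ ω, P.ascentCross (P.iter ξ t ω) = ∑ i, ⟪Z i ω, P.noise (P.iter ξ t ω) i⟫ := fun ω => by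
    refine Finset.sum_congr rfl fun i _ => ?_
    rw [hZ, WithLp.prod_inner_apply]
    simp [real_inner_comm]
  have hint : ∀ i, Integrable (fun ω => ⟪Z i ω, P.noise (P.iter ξ t ω) i⟫) Pr :=
    fun i => integrable_inner_of_memLp (hZ2 i) (h.memLp_noise hs hb t i)
  simp only [e]
  refine ⟨integrable_finsetSum _ fun i _ => hint i, ?_⟩
  rw [integral_finsetSum _ fun i _ => hint i]
  exact Finset.sum_eq_zero fun i _ => h.integral_inner_noise hs hb t i (hZm i) (hZ2 i)

theorem Assumptions.descentCross_iter (h : P.Assumptions) (hs : P.IsSampling Pr ξ) (hb : b ≠ 0)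
    (t : ℕ) : Integrable (fun ω => P.descentCross (P.iter ξ t ω)) Pr ∧
      ∫ ω, P.descentCross (P.iter ξ t ω) ∂Pr = 0 := by
  -- Padding by a zero `y`-block selects the `x`-block of the noise.
  obtain ⟨Z, hZ⟩ : ∃ Z : (i : Fin n) → Ω → Pair d (p i), Z = fun i ω => WithLp.toLp 2
    (P.gradPhi (avg (P.iter ξ t ω).x), 0) := ⟨_, rfl⟩
  have hZm : ∀ i, Measurable[sampleAlg ξ (past n b t)] (Z i) := fun i => by
    let _ := sampleAlg ξ (past n b t)
    rw [hZ]
    exact (WithLp.measurable_toLp 2 _).comp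
      ((h.measurable_gradPhi_iter ξ t).prodMk measurable_const)
  have hZ2 : ∀ i, MemLp (Z i) 2 Pr := fun i => by
    refine (h.memLp_gradPhi_iter hs hb t).of_le
      ((hZm i).mono (hs.sampleAlg_le (past n b t)) le_rfl).aestronglyMeasurable
      (.of_forall fun ω => ?_)
    rw [hZ, WithLp.norm_toLp_fst]
  have e : ∀ ω, P.descentCross (P.iter ξ t ω)
      = (n : ℝ)⁻¹ * ∑ i, ⟪Z i ω, P.noise (P.iter ξ t ω) i⟫ := fun ω => by
    rw [descentCross]
    conv_lhs => rw [avg.eq_1 fun i => (P.noise (P.iter ξ t ω) i).fst]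
    rw [real_inner_smul_right, inner_sum]
    congr 1
    refine Finset.sum_congr rfl fun i _ => ?_
    rw [hZ, WithLp.prod_inner_apply]
    simp
  have hint : ∀ i, Integrable (fun ω => ⟪Z i ω, P.noise (P.iter ξ t ω) i⟫) Pr :=
    fun i => integrable_inner_of_memLp (hZ2 i) (h.memLp_noise hs hb t i)
  simp only [e]
  refine ⟨(integrable_finsetSum _ fun i _ => hint i).const_mul _, ?_⟩
  rw [integral_const_mul, integral_finsetSum _ fun i _ => hint i,
    Finset.sum_eq_zero fun i _ => h.integral_inner_noise hs hb t i (hZm i) (hZ2 i), mul_zero]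

theorem Assumptions.noiseSq_iter (h : P.Assumptions) (hs : P.IsSampling Pr ξ) (hb : b ≠ 0)
    (t : ℕ) : Integrable (fun ω => P.noiseSq (P.iter ξ t ω)) Pr ∧
      ∫ ω, P.noiseSq (P.iter ξ t ω) ∂Pr ≤ n * (P.sigma ^ 2 / b) := by
  have hint : ∀ i, Integrable (fun ω => ‖P.noise (P.iter ξ t ω) i‖ ^ 2) Pr :=
    fun i => (h.memLp_noise hs hb t i).integrable_norm_pow two_ne_zero
  refine ⟨integrable_finsetSum _ fun i _ => hint i, ?_⟩
  simp only [noiseSq]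
  rw [integral_finsetSum _ fun i _ => hint i]
  refine (Finset.sum_le_sum fun i _ => h.integral_norm_sq_noise_le hs hb t i).trans_eq ?_
  simp

theorem Assumptions.integrable_gradPhiSq (h : P.Assumptions) (hs : P.IsSampling Pr ξ)
    (hb : b ≠ 0) (t : ℕ) : Integrable (P.gradPhiSq ξ t) Pr := by
  have e : P.gradPhiSq ξ t = fun ω => ‖P.gradPhi (avg (P.iter ξ t ω).x)‖ ^ 2 :=
    funext fun ω => by rw [gradPhiSq, h.gradient_phi]
  rw [e]
  exact (h.memLp_gradPhi_iter hs hb t).integrable_norm_pow two_ne_zero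

/-- The convergence rate of the averaged squared gradient norms. -/
theorem Assumptions.average_gradPhiSq_le (h : P.Assumptions) (hs : P.IsSampling Pr ξ)
    (hb : b ≠ 0) {T : ℕ} (hT : 1 ≤ T) :
    (1 / (T : ℝ)) * ∑ t ∈ Finset.range T, ∫ ω, P.gradPhiSq ξ t ω ∂Pr
      ≤ 1000 * (P.rate / T) + 12 * (P.kappa * P.sigma ^ 2 / b) := by
  obtain ⟨k, rfl⟩ : ∃ k, T = k + 1 := ⟨T - 1, by omega⟩
  have hn := h.card_pos
  have hk := h.kappa_pos
  obtain ⟨N, hN⟩ : ∃ N : Ω → ℝ,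
    N = fun ω => ∑ t ∈ Finset.range (k + 1), P.noiseSq (P.iter ξ t ω) := ⟨_, rfl⟩
  obtain ⟨A, hA⟩ : ∃ A : Ω → ℝ,
    A = fun ω => ∑ t ∈ Finset.range (k + 1), P.ascentCross (P.iter ξ t ω) := ⟨_, rfl⟩
  obtain ⟨B, hB⟩ : ∃ B : Ω → ℝ,
    B = fun ω => ∑ t ∈ Finset.range (k + 1), P.descentCross (P.iter ξ t ω) := ⟨_, rfl⟩
  have hNi : Integrable N Pr :=
    hN ▸ integrable_finsetSum _ fun t _ => (h.noiseSq_iter hs hb t).1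
  have hAi : Integrable A Pr :=
    hA ▸ integrable_finsetSum _ fun t _ => (h.ascentCross_iter hs hb t).1
  have hBi : Integrable B Pr :=
    hB ▸ integrable_finsetSum _ fun t _ => (h.descentCross_iter hs hb t).1
  have hN0 : ∫ ω, N ω ∂Pr ≤ (k + 1) * (n * (P.sigma ^ 2 / b)) := by
    rw [hN, integral_finsetSum _ fun t _ => (h.noiseSq_iter hs hb t).1]
    refine (Finset.sum_le_sum fun t _ => (h.noiseSq_iter hs hb t).2).trans_eq ?_
    simp
  have hA0 : ∫ ω, A ω ∂Pr = 0 := by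
    rw [hA, integral_finsetSum _ fun t _ => (h.ascentCross_iter hs hb t).1]
    exact Finset.sum_eq_zero fun t _ => (h.ascentCross_iter hs hb t).2
  have hB0 : ∫ ω, B ω ∂Pr = 0 := by
    rw [hB, integral_finsetSum _ fun t _ => (h.descentCross_iter hs hb t).1]
    exact Finset.sum_eq_zero fun t _ => (h.descentCross_iter hs hb t).2
  have hbound : ∀ ω, ∑ t ∈ Finset.range (k + 1), P.gradPhiSq ξ t ω
      ≤ 1000 * P.rate + 12 * (P.kappa / n * N ω) + P.ascentWeight * A ω - 2 * B ω := fun ω => by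
    have h1 := h.sum_norm_sq_gradPhi_le (fun t i j => ξ t i j ω) k
    rw [hN, hA, hB]
    refine le_trans (le_of_eq ?_) h1
    exact Finset.sum_congr rfl fun t _ => by rw [gradPhiSq, h.gradient_phi]; rfl
  have i1 : Integrable (fun ω => 1000 * P.rate + 12 * (P.kappa / n * N ω)) Pr :=
    (integrable_const _).add ((hNi.const_mul _).const_mul _)
  have i2 : Integrable (fun ω => 1000 * P.rate + 12 * (P.kappa / n * N ω)
      + P.ascentWeight * A ω) Pr := i1.add (hAi.const_mul _)
  have h2 : ∑ t ∈ Finset.range (k + 1), ∫ ω, P.gradPhiSq ξ t ω ∂Pr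
      ≤ 1000 * P.rate + 12 * (P.kappa / n * ((k + 1) * (n * (P.sigma ^ 2 / b)))) := by
    rw [← integral_finsetSum _ fun t _ => h.integrable_gradPhiSq hs hb t]
    refine (integral_mono (integrable_finsetSum _ fun t _ => h.integrable_gradPhiSq hs hb t)
      (i2.sub (hBi.const_mul 2)) hbound).trans ?_
    simp only [Pi.sub_apply]
    rw [integral_sub i2 (hBi.const_mul 2), integral_add i1 (hAi.const_mul _),
      integral_add (integrable_const _) ((hNi.const_mul _).const_mul _),
      integral_const_mul 12, integral_const_mul (P.kappa / n), integral_const_mul P.ascentWeight,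
      integral_const_mul 2, hA0, hB0]
    simp only [integral_const, probReal_univ, one_smul, mul_zero, add_zero, sub_zero]
    gcongr
  have hT0 : (0 : ℝ) < k + 1 := by positivity
  push_cast
  rw [one_div, inv_mul_le_iff₀ hT0]
  refine h2.trans_eq ?_
  field_simp

end Expectation

/-! ### Query counts and comparison of the rates -/

theorem calls_iter {b : ℕ} {Ω : Type v} (P : Problem n d p Ξ)
    (ξ : ℕ → (i : Fin n) → Fin b → Ω → Ξ i) (t : ℕ) (ω : Ω) (i : Fin n) :
    (P.iter ξ t ω).calls i = (t + 1) * b := by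
  induction t with
  | zero => simp [iter, run, init]
  | succ t ih =>
    change (P.iter ξ t ω).calls i + b = _
    rw [ih]
    ring

theorem Assumptions.rate_nonneg (h : P.Assumptions) : 0 ≤ P.rate := by
  have := h.gap_nonneg
  have := h.kappa_pos
  have := h.L_pos
  have := P.consErr_nonneg
  have := P.gradSq_nonneg
  have := h.one_sub_lam_pos
  unfold rate
  positivity

theorem Assumptions.rate_le_kappa_sq_mul_netFactor (h : P.Assumptions) :
    P.rate ≤ P.kappa ^ 2 * P.netFactor := by
  have h1 := h.gap_nonneg
  have h2 := h.L_pos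
  have h3 := P.consErr_nonneg
  have h4 := P.gradSq_nonneg
  have h5 := h.one_sub_lam_pos
  have hk := h.one_le_kappa
  have hk2 : P.kappa ≤ P.kappa ^ 2 := le_self_pow₀ hk two_ne_zero
  have hk3 : 1 ≤ P.kappa ^ 2 := one_le_pow₀ hk
  have a1 : P.gap * P.kappa * P.L / (1 - P.lam) ^ 2
      ≤ P.kappa ^ 2 * (P.gap * P.L / (1 - P.lam) ^ 2) := by
    calc _ = P.kappa * (P.gap * P.L / (1 - P.lam) ^ 2) := by ring
      _ ≤ _ := by gcongr
  have a2 : P.D ^ 2 * P.kappa * P.L ^ 2 / √(1 - P.lam)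
      ≤ P.kappa ^ 2 * (P.D ^ 2 * P.L ^ 2 / √(1 - P.lam)) := by
    calc _ = P.kappa * (P.D ^ 2 * P.L ^ 2 / √(1 - P.lam)) := by ring
      _ ≤ _ := by gcongr
  have a3 : P.gradSq / n ≤ P.kappa ^ 2 * (P.gradSq / n) :=
    le_mul_of_one_le_left (by positivity) hk3
  unfold rate netFactor
  linarith [show P.gap * P.kappa ^ 2 * P.L / √(1 - P.lam)
      = P.kappa ^ 2 * (P.gap * P.L / √(1 - P.lam)) by ring,
    show P.kappa ^ 2 * P.L ^ 2 * P.consErr / (n * (1 - P.lam))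
      = P.kappa ^ 2 * (P.L ^ 2 * P.consErr / (n * (1 - P.lam))) by ring]

theorem Assumptions.rate_le_centralRate (h : P.Assumptions) (hlam : P.lam = 0)
    (hx : ∀ j k, P.x0 j = P.x0 k) : P.rate ≤ 2 * P.centralRate := by
  have h1 := h.gap_nonneg
  have h2 := h.L_pos
  have h4 := P.gradSq_nonneg
  have hk := h.one_le_kappa
  have hn := h.card_pos
  have hk2 : P.kappa ≤ P.kappa ^ 2 := le_self_pow₀ hk two_ne_zero
  have hc : P.consErr = 0 := by
    refine Finset.sum_eq_zero fun i _ => ?_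
    have e : P.x0 = fun _ => P.x0 i := funext fun j => hx j i
    have e2 : avg P.x0 = P.x0 i := by
      rw [avg, e]
      simp [← Nat.cast_smul_eq_nsmul ℝ, smul_smul, hn.ne']
    rw [e2]
    simp
  have a1 : P.gap * P.kappa * P.L ≤ P.gap * P.kappa ^ 2 * P.L := by gcongr
  have a2 : 0 ≤ P.D ^ 2 * P.kappa * P.L ^ 2 := by
    have := h.kappa_pos
    positivity
  have a3 : 0 ≤ P.gradSq / n := by positivity
  rw [rate, centralRate, hc, hlam]
  simp only [sub_zero, one_pow, div_one, Real.sqrt_one, mul_zero, zero_div]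
  linarith

end Problem

/-- Rounding up at most doubles a number that is at least `1`. The factor `2000` serves both `b` and
`T`, as `1000/2000 + 12/2000 < 1` in the averaged bound. -/
theorem ceil_max_one_le {a : ℝ} : (⌈max 1 (2000 * a)⌉₊ : ℝ) ≤ 4000 * max 1 a := by
  have h1 := (Nat.ceil_lt_add_one (zero_le_one.trans (le_max_left 1 (2000 * a)))).le
  have h2 : max 1 (2000 * a) ≤ 2000 * max 1 a := by
    refine max_le ?_ ?_
    · linarith [le_max_left 1 a]
    · linarith [le_max_right 1 a]
  linarith [le_max_left 1 a]

end DSGTA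

end

theorem corollary3 :
    ∃ C : ℝ, 0 < C ∧
      ∀ (n d : ℕ) (p : Fin n → ℕ) (Ξ : Fin n → Type u) [∀ i, MeasurableSpace (Ξ i)]
        (P : DSGTA.Problem n d p Ξ), P.Assumptions →
        Differentiable ℝ P.Phi ∧
        -- convergence rate, for every batch size and every horizon
        (∀ b T : ℕ, 1 ≤ b → 1 ≤ T →
          ∀ (Ω : Type v) [MeasurableSpace Ω] (Pr : Measure Ω)
            (ξ : ℕ → (i : Fin n) → Fin b → Ω → Ξ i), P.IsSampling Pr ξ →
            (∀ t, Integrable (P.gradPhiSq ξ t) Pr) ∧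
            (1 / (T : ℝ)) * ∑ t ∈ Finset.range T, ∫ ω, P.gradPhiSq ξ t ω ∂Pr
              ≤ C * (P.gap * P.kappa * P.L / ((1 - P.lam) ^ 2 * T)
                + P.gap * P.kappa ^ 2 * P.L / (√(1 - P.lam) * T)
                + P.kappa ^ 2 * P.L ^ 2 * P.consErr / (n * (1 - P.lam) * T)
                + P.D ^ 2 * P.kappa * P.L ^ 2 / (√(1 - P.lam) * T)
                + P.gradSq / (n * T)
                + P.kappa * P.sigma ^ 2 / b)) ∧
        -- iteration and sample complexity, with a batch size of order `κσ²/ε²`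
        (∀ ε : ℝ, 0 < ε → ∃ b T : ℕ, 1 ≤ b ∧ 1 ≤ T ∧
          P.kappa * P.sigma ^ 2 / ε ^ 2 ≤ b ∧
          (b : ℝ) ≤ C * max 1 (P.kappa * P.sigma ^ 2 / ε ^ 2) ∧
          (T : ℝ) ≤ C * max 1 (P.rate / ε ^ 2) ∧
          (T : ℝ) ≤ C * max 1 (P.kappa ^ 2 * P.netFactor / ε ^ 2) ∧
          ∀ (Ω : Type v) [MeasurableSpace Ω] (Pr : Measure Ω)
            (ξ : ℕ → (i : Fin n) → Fin b → Ω → Ξ i), P.IsSampling Pr ξ →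
            (1 / (T : ℝ)) * ∑ t ∈ Finset.range T, ∫ ω, P.gradPhiSq ξ t ω ∂Pr ≤ ε ^ 2 ∧
            (∃ t < T, ∫ ω, P.gradPhiSq ξ t ω ∂Pr ≤ ε ^ 2) ∧
            -- oracle queries of each agent in these `T` iterations
            ∀ ω i,
              ((P.iter ξ T ω).calls i : ℝ)
                ≤ C * max 1 (P.rate / ε ^ 2) * max 1 (P.kappa * P.sigma ^ 2 / ε ^ 2) ∧
              ((P.iter ξ T ω).calls i : ℝ)
                ≤ C * max 1 (P.kappa ^ 2 * P.netFactor / ε ^ 2)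
                  * max 1 (P.kappa * P.sigma ^ 2 / ε ^ 2) ∧
              -- common initial point and complete graph
              (P.lam = 0 → (∀ j k, P.x0 j = P.x0 k) →
                ((P.iter ξ T ω).calls i : ℝ)
                  ≤ C * max 1 (P.centralRate / ε ^ 2)
                    * max 1 (P.kappa * P.sigma ^ 2 / ε ^ 2))) := by
  -- The largest requirement is the query count: `8000 · 4000` rounded up to `5 · 10⁷`, doubled for
  -- the centralized rate.
  refine ⟨10 ^ 8, by norm_num, fun n d p Ξ _ P h => ⟨h.differentiable_phi, ?_, ?_⟩⟩
  · intro b T hb hT Ω _ Pr ξ hs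
    have := hs.prob
    have hb0 : b ≠ 0 := by omega
    refine ⟨h.integrable_gradPhiSq hs hb0, (h.average_gradPhiSq_le hs hb0 hT).trans ?_⟩
    have e : P.gap * P.kappa * P.L / ((1 - P.lam) ^ 2 * T)
        + P.gap * P.kappa ^ 2 * P.L / (√(1 - P.lam) * T)
        + P.kappa ^ 2 * P.L ^ 2 * P.consErr / (n * (1 - P.lam) * T)
        + P.D ^ 2 * P.kappa * P.L ^ 2 / (√(1 - P.lam) * T)
        + P.gradSq / (n * T) = P.rate / T := by
      simp only [DSGTA.Problem.rate, add_div, div_div]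
    rw [e]
    have h1 : 0 ≤ P.rate / T := div_nonneg h.rate_nonneg (by positivity)
    have h2 : 0 ≤ P.kappa * P.sigma ^ 2 / b := by
      have := h.kappa_pos
      positivity
    linarith
  · intro ε hε
    have hε2 : 0 < ε ^ 2 := by positivity
    have hkσ : 0 ≤ P.kappa * P.sigma ^ 2 := mul_nonneg h.kappa_pos.le (sq_nonneg _)
    obtain ⟨r, hr⟩ : ∃ r, r = P.rate / ε ^ 2 := ⟨_, rfl⟩
    obtain ⟨s, hs⟩ : ∃ s, s = P.kappa * P.sigma ^ 2 / ε ^ 2 := ⟨_, rfl⟩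
    have hr0 : 0 ≤ r := hr ▸ div_nonneg h.rate_nonneg hε2.le
    have hs0 : 0 ≤ s := hs ▸ div_nonneg hkσ hε2.le
    obtain ⟨b, hbdef⟩ : ∃ b, b = ⌈max 1 (2000 * s)⌉₊ := ⟨_, rfl⟩
    obtain ⟨T, hTdef⟩ : ∃ T, T = ⌈max 1 (2000 * r)⌉₊ := ⟨_, rfl⟩
    have hb1 : max 1 (2000 * s) ≤ b := hbdef ▸ Nat.le_ceil _
    have hT1 : max 1 (2000 * r) ≤ T := hTdef ▸ Nat.le_ceil _
    have hb2 : (b : ℝ) ≤ 4000 * max 1 s := hbdef ▸ DSGTA.ceil_max_one_le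
    have hT2 : (T : ℝ) ≤ 4000 * max 1 r := hTdef ▸ DSGTA.ceil_max_one_le
    have hb1' : (1 : ℝ) ≤ b := (le_max_left _ _).trans hb1
    have hT1' : (1 : ℝ) ≤ T := (le_max_left _ _).trans hT1
    have hb : 1 ≤ b := by exact_mod_cast hb1'
    have hT : 1 ≤ T := by exact_mod_cast hT1'
    have hb3 : 2000 * s ≤ b := (le_max_right _ _).trans hb1
    have hT3 : 2000 * r ≤ T := (le_max_right _ _).trans hT1
    have hmr : 1 ≤ max 1 r := le_max_left _ _
    have hms : 1 ≤ max 1 s := le_max_left _ _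
    have hnet : max 1 r ≤ max 1 (P.kappa ^ 2 * P.netFactor / ε ^ 2) := by
      rw [hr]
      gcongr
      exact h.rate_le_kappa_sq_mul_netFactor
    -- The extra `1` counts the initial batch, and `T + 1 ≤ 8000 * max 1 r`.
    have hcalls : ((T + 1) * b : ℝ) ≤ 5 * 10 ^ 7 * max 1 r * max 1 s := by
      calc ((T + 1) * b : ℝ) ≤ (8000 * max 1 r) * (4000 * max 1 s) := by
            gcongr
            linarith
        _ = 32 * 10 ^ 6 * (max 1 r * max 1 s) := by ring
        _ ≤ 50 * 10 ^ 6 * (max 1 r * max 1 s) := by gcongr; norm_num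
        _ = _ := by ring
    rw [← hs, ← hr]
    refine ⟨b, T, hb, hT, by linarith, by linarith, by linarith, by linarith, ?_⟩
    intro Ω _ Pr ξ hS
    have := hS.prob
    have havg : (1 / (T : ℝ)) * ∑ t ∈ Finset.range T, ∫ ω, P.gradPhiSq ξ t ω ∂Pr ≤ ε ^ 2 := by
      refine (h.average_gradPhiSq_le hS (by omega) hT).trans ?_
      have h1 : P.rate / T ≤ ε ^ 2 / 2000 := by
        rw [div_le_iff₀ (by linarith)]
        rw [hr, ← mul_div_assoc, div_le_iff₀ hε2] at hT3
        linarith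
      have h2 : P.kappa * P.sigma ^ 2 / b ≤ ε ^ 2 / 2000 := by
        rw [div_le_iff₀ (by linarith)]
        rw [hs, ← mul_div_assoc, div_le_iff₀ hε2] at hb3
        linarith
      linarith
    refine ⟨havg, ?_, fun ω i => ?_⟩
    · have h1 : ∑ t ∈ Finset.range T, ∫ ω, P.gradPhiSq ξ t ω ∂Pr
          ≤ ∑ _t ∈ Finset.range T, ε ^ 2 := by
        rw [one_div, inv_mul_le_iff₀ (by linarith)] at havg
        simpa using havg
      -- Some term of the sum does not exceed the average.
      obtain ⟨t, ht, hle⟩ := Finset.exists_le_of_sum_le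
        (Finset.nonempty_range_iff.2 (by omega)) h1
      exact ⟨t, Finset.mem_range.1 ht, hle⟩
    · rw [P.calls_iter]
      push_cast
      have h1 : 5 * 10 ^ 7 * max 1 r * max 1 s ≤ 10 ^ 8 * max 1 r * max 1 s := by
        gcongr
        norm_num
      refine ⟨hcalls.trans h1, (hcalls.trans h1).trans (by gcongr), fun hlam hx => ?_⟩
      refine hcalls.trans ?_
      have h2 : max 1 r ≤ 2 * max 1 (P.centralRate / ε ^ 2) := by
        refine max_le (by linarith [le_max_left 1 (P.centralRate / ε ^ 2)]) ?_
        have : r ≤ 2 * (P.centralRate / ε ^ 2) := by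
          rw [hr, ← mul_div_assoc]
          gcongr
          exact h.rate_le_centralRate hlam hx
        linarith [le_max_right 1 (P.centralRate / ε ^ 2)]
      calc _ ≤ 5 * 10 ^ 7 * (2 * max 1 (P.centralRate / ε ^ 2)) * max 1 s := by gcongr
        _ = _ := by ring
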